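/- A *ceer* is a computably enumerable equivalence relation on $\mathbb N$. For equivalence relations $R,S$ on $\mathbb N$ write $R\le S$ if there is a total computable $f$ with $x\,R\,y\iff f(x)\,S\,f(y)$ for all $x,y$. The uniform join $R\oplus S$ copies $R$ on the even numbers and $S$ on the odd numbers; $\mathrm{Id}_k$ ($k\ge 1$) is congruence modulo $k$, and $R\oplus\mathrm{Id}_0:=R$. Write $R\le_{\mathcal I}S$ if $R\le S\oplus\mathrm{Id}_k$ for some $k\ge 0$; the classes of ceers under the induced equivalence $\equiv_{\mathcal I}$ are the *$\mathcal I$-degrees*, partially ordered by $\le_{\mathcal I}$, with least element $\boldsymbol 0$ the degree of the finite ceers (those with finitely many classes). A ceer is *light* if there is an infinite c.e. set of pairwise inequivalent numbers, and *dark* if it is neither finite nor light; an $\mathcal I$-degree is dark if it contains a dark ceer. An $\mathcal I$-degree $\boldsymbol a$ is an *$\mathcal I$-strongly minimal cover* of the pair $\boldsymbol d,\boldsymbol e$ if $\boldsymbol d,\boldsymbol e$ are incomparable, $\boldsymbol d,\boldsymbol e<_{\mathcal I}\boldsymbol a$, and every $\boldsymbol x<_{\mathcal I}\boldsymbol a$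 satisfies $\boldsymbol x\le_{\mathcal I}\boldsymbol d$ or $\boldsymbol x\le_{\mathcal I}\boldsymbol e$. For an $\mathcal I$-degree $\boldsymbol c$ let $G_{\boldsymbol c}$ be the graph whose vertices are the minimal nonzero $\mathcal I$-degrees $\le_{\mathcal I}\boldsymbol c$, with an edge between $\boldsymbol d$ and $\boldsymbol e$ if and only if there are two incomparable $\mathcal I$-degrees $\boldsymbol a,\boldsymbol b\le_{\mathcal I}\boldsymbol c$ which are both $\mathcal I$-strongly minimal covers of the pair $\boldsymbol d,\boldsymbol e$. **Theorem.** Let $G=(V,E)$ be a computable graph, i.e. $V\subseteq\mathbb N$ is a nonempty computable set and $E$ is a computable, irreflexive and symmetric relation on $V$. Then there is a dark $\mathcal I$-degree $\boldsymbol c$ such that $G_{\boldsymbol c}$ is isomorphic to the disjoint union of $G$ with a (possibly empty) graph which has no edges. -/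

import Mathlib

/-- `R ≤ S`: computable reducibility between equivalence relations on `ℕ`. -/
def CompReducible (R S : Setoid ℕ) : Prop :=
  ∃ f : ℕ → ℕ, Computable f ∧ ∀ x y, R x y ↔ S (f x) (f y)

/-- The uniform join `R ⊕ S`: a copy of `R` on the even numbers and of `S` on the odd numbers. -/
def uniformJoin (R S : Setoid ℕ) : Setoid ℕ where
  r x y := (∃ u v, x = 2 * u ∧ y = 2 * v ∧ R u v) ∨
    (∃ u v, x = 2 * u + 1 ∧ y = 2 * v + 1 ∧ S u v)
  iseqv := by
    refine ⟨fun x => ?_, ?_, ?_⟩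
    · rcases Nat.even_or_odd' x with ⟨u, h | h⟩
      · exact Or.inl ⟨u, u, h, h, R.refl u⟩
      · exact Or.inr ⟨u, u, h, h, S.refl u⟩
    · rintro x y (⟨u, v, hx, hy, h⟩ | ⟨u, v, hx, hy, h⟩)
      · exact Or.inl ⟨v, u, hy, hx, R.symm h⟩
      · exact Or.inr ⟨v, u, hy, hx, S.symm h⟩
    · rintro x y z (⟨u, v, hx, hy, h⟩ | ⟨u, v, hx, hy, h⟩) (⟨u', v', hy', hz, h'⟩ | ⟨u', v', hy', hz, h'⟩)
      · obtain rfl : v = u' := by omega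
        exact Or.inl ⟨u, v', hx, hz, R.trans h h'⟩
      · omega
      · omega
      · obtain rfl : v = u' := by omega
        exact Or.inr ⟨u, v', hx, hz, S.trans h h'⟩

/-- `Id_n`: congruence modulo `n`. It has exactly `n` classes if `n ≥ 1`. -/
def idMod (n : ℕ) : Setoid ℕ where
  r x y := x ≡ y [MOD n]
  iseqv := ⟨fun x => Nat.ModEq.refl x, fun h => h.symm, fun h h' => h.trans h'⟩

/-- `R ⊕ Id_k`, with the convention `R ⊕ Id_0 = R`. -/
def joinId (R : Setoid ℕ) : ℕ → Setoid ℕ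
  | 0 => R
  | k + 1 => uniformJoin R (idMod (k + 1))

/-- `R ≤_I S`: reducibility modulo the finite ceers. -/
def LeI (R S : Setoid ℕ) : Prop := ∃ k, CompReducible R (joinId S k)

theorem LeI.refl (R : Setoid ℕ) : LeI R R :=
  ⟨0, id, Computable.id, fun _ _ => Iff.rfl⟩

theorem uniformJoin_even_even (R S : Setoid ℕ) (u v : ℕ) :
    (uniformJoin R S) (2 * u) (2 * v) ↔ R u v := by
  constructor
  · rintro (⟨a, b, h1, h2, h⟩ | ⟨a, b, h1, h2, h⟩)
    · obtain rfl : u = a := by omega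
      obtain rfl : v = b := by omega
      exact h
    · omega
  · exact fun h => Or.inl ⟨u, v, rfl, rfl, h⟩

theorem uniformJoin_odd_odd (R S : Setoid ℕ) (u v : ℕ) :
    (uniformJoin R S) (2 * u + 1) (2 * v + 1) ↔ S u v := by
  constructor
  · rintro (⟨a, b, h1, h2, h⟩ | ⟨a, b, h1, h2, h⟩)
    · omega
    · obtain rfl : u = a := by omega
      obtain rfl : v = b := by omega
      exact h
  · exact fun h => Or.inr ⟨u, v, rfl, rfl, h⟩

theorem uniformJoin_even_odd (R S : Setoid ℕ) (u v : ℕ) :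
    ¬ (uniformJoin R S) (2 * u) (2 * v + 1) := by
  rintro (⟨a, b, h1, h2, h⟩ | ⟨a, b, h1, h2, h⟩) <;> omega

theorem uniformJoin_odd_even (R S : Setoid ℕ) (u v : ℕ) :
    ¬ (uniformJoin R S) (2 * u + 1) (2 * v) := by
  rintro (⟨a, b, h1, h2, h⟩ | ⟨a, b, h1, h2, h⟩) <;> omega

theorem joinId_succ (R : Setoid ℕ) (k x y : ℕ) :
    (joinId R (k + 1)) x y ↔ (uniformJoin R (idMod (k + 1))) x y := Iff.rfl

theorem compReducible_joinId_succ {R S : Setoid ℕ} {k : ℕ} (h : CompReducible R (joinId S k)) :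
    CompReducible R (joinId S (k + 1)) := by
  obtain ⟨f, hf, hR⟩ := h
  cases k with
  | zero =>
    exact ⟨fun x => 2 * f x, (Primrec.nat_double.to_comp).comp hf, fun x y => (hR x y).trans
      (uniformJoin_even_even S _ _ _).symm⟩
  | succ k =>
    refine ⟨fun x => if f x % 2 = 0 then f x else 2 * (f x / 2 % (k + 1)) + 1, ?_, ?_⟩
    · have hg : Primrec fun n : ℕ => if n % 2 = 0 then n else 2 * (n / 2 % (k + 1)) + 1 :=
        Primrec.ite (Primrec.eq.comp (Primrec.nat_mod.comp Primrec.id (Primrec.const 2))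
          (Primrec.const 0)) Primrec.id
          (Primrec.nat_double_succ.comp (Primrec.nat_mod.comp
            (Primrec.nat_div.comp Primrec.id (Primrec.const 2)) (Primrec.const (k + 1))))
      exact hg.to_comp.comp hf
    · intro x y
      rw [hR x y, joinId_succ, joinId_succ]
      rcases Nat.even_or_odd' (f x) with ⟨u, hu | hu⟩ <;>
      rcases Nat.even_or_odd' (f y) with ⟨v, hv | hv⟩
      · simp [hu, hv, uniformJoin_even_even]
      · have h1 : (2 * v + 1) / 2 = v := by omega
        simp [hu, hv, h1, uniformJoin_even_odd, Nat.add_mod]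
      · have h1 : (2 * u + 1) / 2 = u := by omega
        simp [hu, hv, h1, uniformJoin_odd_even, Nat.add_mod]
      · have h1 : (2 * u + 1) / 2 = u := by omega
        have h2 : (2 * v + 1) / 2 = v := by omega
        have h3 : (2 * u + 1) % 2 = 1 := by omega
        have h4 : (2 * v + 1) % 2 = 1 := by omega
        have hu' : u % (k + 1) < k + 1 := Nat.mod_lt _ (by omega)
        have hv' : v % (k + 1) < k + 1 := Nat.mod_lt _ (by omega)
        simp only [hu, hv, h1, h2, h3, h4, uniformJoin_odd_odd, one_ne_zero, if_false]
        change u % (k + 1) = v % (k + 1) ↔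
          u % (k + 1) % (k + 1 + 1) = v % (k + 1) % (k + 1 + 1)
        rw [Nat.mod_eq_of_lt (hu'.trans (Nat.lt_succ_self _)),
          Nat.mod_eq_of_lt (hv'.trans (Nat.lt_succ_self _))]

theorem LeI.trans {R S T : Setoid ℕ} (h₁ : LeI R S) (h₂ : LeI S T) : LeI R T := by
  obtain ⟨k, hk⟩ := h₁
  obtain ⟨m, hm⟩ := h₂
  obtain ⟨f, hf, hR⟩ := compReducible_joinId_succ hk
  obtain ⟨g, hg, hS⟩ := compReducible_joinId_succ hm
  refine ⟨m + 1 + (k + 1), fun x => if f x % 2 = 0 then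
    (if g (f x / 2) % 2 = 0 then g (f x / 2) else 2 * (g (f x / 2) / 2 % (m + 1)) + 1)
    else 2 * (m + 1 + f x / 2 % (k + 1)) + 1, ?_, ?_⟩
  · have hp : Primrec fun n : ℕ => if n % 2 = 0 then n else 2 * (n / 2 % (m + 1)) + 1 :=
      Primrec.ite (Primrec.eq.comp (Primrec.nat_mod.comp Primrec.id (Primrec.const 2))
        (Primrec.const 0)) Primrec.id
        (Primrec.nat_double_succ.comp (Primrec.nat_mod.comp
          (Primrec.nat_div.comp Primrec.id (Primrec.const 2)) (Primrec.const (m + 1))))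
    have hq : Primrec fun n : ℕ => 2 * (m + 1 + n / 2 % (k + 1)) + 1 :=
      Primrec.nat_double_succ.comp (Primrec.nat_add.comp (Primrec.const (m + 1))
        (Primrec.nat_mod.comp
          (Primrec.nat_div.comp Primrec.id (Primrec.const 2)) (Primrec.const (k + 1))))
    have hd : Primrec fun n : ℕ => n / 2 := Primrec.nat_div.comp Primrec.id (Primrec.const 2)
    have hb : Primrec fun n : ℕ => decide (n % 2 = 0) :=
      (Primrec.eq.comp (Primrec.nat_mod.comp Primrec.id (Primrec.const 2))
        (Primrec.const 0)).decide
    refine (Computable.cond (hb.to_comp.comp hf)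
      (hp.to_comp.comp (hg.comp (hd.to_comp.comp hf))) (hq.to_comp.comp hf)).of_eq fun x => ?_
    by_cases hx : f x % 2 = 0 <;> simp [hx]
  · have key : ∀ a b : ℕ, (idMod (m + 1 + (k + 1))) a b ↔
        a % (m + 1 + (k + 1)) = b % (m + 1 + (k + 1)) := fun a b => Iff.rfl
    have keyk : ∀ a b : ℕ, (idMod (k + 1)) a b ↔ a % (k + 1) = b % (k + 1) := fun a b => Iff.rfl
    have keym : ∀ a b : ℕ, (idMod (m + 1)) a b ↔ a % (m + 1) = b % (m + 1) := fun a b => Iff.rfl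
    have hlm : ∀ a, a % (m + 1) < m + 1 := fun a => Nat.mod_lt _ (by omega)
    have hlk : ∀ a, a % (k + 1) < k + 1 := fun a => Nat.mod_lt _ (by omega)
    have hm' : ∀ a, a % (m + 1) % (m + 1 + (k + 1)) = a % (m + 1) := fun a =>
      Nat.mod_eq_of_lt ((hlm a).trans (by omega))
    have hk' : ∀ a, (m + 1 + a % (k + 1)) % (m + 1 + (k + 1)) = m + 1 + a % (k + 1) := fun a =>
      Nat.mod_eq_of_lt (by have := hlk a; omega)
    have e1 : ∀ a, 2 * a / 2 = a := fun a => by omega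
    have e2 : ∀ a, (2 * a + 1) / 2 = a := fun a => by omega
    have e3 : ∀ a, 2 * a % 2 = 0 := fun a => by omega
    have e4 : ∀ a, (2 * a + 1) % 2 = 1 := fun a => by omega
    have hj : joinId T (m + 1 + (k + 1)) = uniformJoin T (idMod (m + 1 + (k + 1))) := rfl
    intro x y
    rw [hR x y, joinId_succ, hj]
    rcases Nat.even_or_odd' (f x) with ⟨u, hu | hu⟩ <;>
    rcases Nat.even_or_odd' (f y) with ⟨v, hv | hv⟩
    · simp only [hu, hv, uniformJoin_even_even, e1, e3, if_true]
      rw [hS u v, joinId_succ]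
      rcases Nat.even_or_odd' (g u) with ⟨a, ha | ha⟩ <;>
      rcases Nat.even_or_odd' (g v) with ⟨b, hb | hb⟩ <;>
      simp only [ha, hb, e1, e2, e3, e4, if_true, if_false, one_ne_zero,
        uniformJoin_even_even, uniformJoin_even_odd, uniformJoin_odd_even, uniformJoin_odd_odd,
        key, keym, hm']
    · simp only [hu, hv, uniformJoin_even_odd, e1, e2, e3, e4, if_true, if_false, one_ne_zero]
      rcases Nat.even_or_odd' (g u) with ⟨a, ha | ha⟩
      · simp only [ha, e3, if_true, uniformJoin_even_odd]
      · simp only [ha, e2, e4, if_false, one_ne_zero, uniformJoin_odd_odd, key, hm', hk',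
          false_iff]
        have := hlm a
        omega
    · simp only [hu, hv, uniformJoin_odd_even, e1, e2, e3, e4, if_true, if_false, one_ne_zero]
      rcases Nat.even_or_odd' (g v) with ⟨a, ha | ha⟩
      · simp only [ha, e3, if_true, uniformJoin_odd_even]
      · simp only [ha, e2, e4, if_false, one_ne_zero, uniformJoin_odd_odd, key, hm', hk',
          false_iff]
        have := hlm a
        omega
    · simp only [hu, hv, e2, e4, if_false, one_ne_zero, uniformJoin_odd_odd, key, keyk, hk']
      omega

/-- A ceer: a computably enumerable equivalence relation on `ℕ`. -/
structure Ceer where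
  rel : Setoid ℕ
  ce : REPred fun p : ℕ × ℕ => rel p.1 p.2

namespace Ceer

/-- `R` is finite if it has only finitely many classes. -/
def IsFinite (R : Ceer) : Prop := Finite (Quotient R.rel)

/-- `R` is light if it has an infinite c.e. transversal, i.e. an infinite c.e. set of pairwise
inequivalent numbers. -/
def IsLight (R : Ceer) : Prop :=
  ∃ W : Set ℕ, W.Infinite ∧ (REPred fun x => x ∈ W) ∧
    ∀ x ∈ W, ∀ y ∈ W, x ≠ y → ¬ R.rel x y

/-- `R` is dark if it is neither finite nor light. -/
def IsDark (R : Ceer) : Prop := ¬ R.IsFinite ∧ ¬ R.IsLight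

/-- `R ≡_I S`, as a setoid on ceers. -/
def iEquiv : Setoid Ceer where
  r R S := LeI R.rel S.rel ∧ LeI S.rel R.rel
  iseqv := ⟨fun _ => ⟨LeI.refl _, LeI.refl _⟩, fun h => ⟨h.2, h.1⟩,
    fun h h' => ⟨h.1.trans h'.1, h'.2.trans h.2⟩⟩

/-- The ceer `Id_1`, with a single class. -/
def one : Ceer where
  rel := idMod 1
  ce := by
    have h : ComputablePred fun _ : ℕ × ℕ => True :=
      ⟨fun _ => isTrue trivial, (Computable.const true).of_eq fun _ => by simp⟩
    exact h.to_re.of_eq fun p => ⟨fun _ => Nat.modEq_one, fun _ => trivial⟩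

end Ceer

/-- The `I`-degrees of ceers. -/
def IDegree : Type := Quotient Ceer.iEquiv

/-- The `I`-degree of a ceer. -/
def Ceer.iDeg (R : Ceer) : IDegree := Quotient.mk Ceer.iEquiv R

namespace IDegree

/-- The partial order on `I`-degrees induced by `≤_I`. -/
instance : PartialOrder IDegree where
  le := Quotient.lift₂ (fun R S : Ceer => LeI R.rel S.rel) (by
    intro _ _ _ _ hR hS
    exact propext ⟨fun h => (hR.2.trans h).trans hS.1, fun h => (hR.1.trans h).trans hS.2⟩)
  le_refl := by
    rintro ⟨R⟩
    exact LeI.refl R.rel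
  le_trans := by
    rintro ⟨R⟩ ⟨S⟩ ⟨T⟩ h h'
    exact LeI.trans (S := S.rel) h h'
  le_antisymm := by
    rintro ⟨R⟩ ⟨S⟩ h h'
    exact Quotient.sound ⟨h, h'⟩

/-- The least `I`-degree; it consists of the finite ceers. -/
instance : OrderBot IDegree where
  bot := Ceer.one.iDeg
  bot_le := by
    rintro ⟨R⟩
    exact ⟨0, fun _ => 0, Computable.const 0,
      fun x y => ⟨fun _ => R.rel.refl 0, fun _ => Nat.modEq_one⟩⟩

/-- An `I`-degree is dark if it is the `I`-degree of a dark ceer. -/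
def IsDark (c : IDegree) : Prop := ∃ R : Ceer, R.IsDark ∧ R.iDeg = c

/-- `a` is an `I`-strongly minimal cover of the pair `d, e`. -/
def IsStronglyMinimalCover (a d e : IDegree) : Prop :=
  (¬ d ≤ e ∧ ¬ e ≤ d) ∧ (d < a ∧ e < a) ∧ ∀ x, x < a → x ≤ d ∨ x ≤ e

/-- The graph `G_c`: its vertices are the minimal (nonzero) `I`-degrees below `c`; two of them are
joined by an edge iff there are two incomparable `I`-degrees `a, b ≤ c` which are both
`I`-strongly minimal covers of the pair. -/
def graph (c : IDegree) : SimpleGraph {d : IDegree // IsAtom d ∧ d ≤ c} where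
  Adj d e := ∃ a b : IDegree, a ≤ c ∧ b ≤ c ∧ (¬ a ≤ b ∧ ¬ b ≤ a) ∧
    IsStronglyMinimalCover a d e ∧ IsStronglyMinimalCover b d e
  symm := by
    constructor
    rintro d e ⟨a, b, ha, hb, hab, h, h'⟩
    exact ⟨a, b, ha, hb, hab, ⟨h.1.symm, h.2.1.symm, fun x hx => (h.2.2 x hx).symm⟩,
      ⟨h'.1.symm, h'.2.1.symm, fun x hx => (h'.2.2 x hx).symm⟩⟩
  loopless := by
    constructor
    rintro d ⟨a, b, -, -, -, h, -⟩
    exact h.1.1 le_rfl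

end IDegree

/-- A graph `G` whose vertex set is a set `V` of natural numbers is computable if both the vertex
set and the edge relation are computable. -/
def IsComputableGraph {V : Set ℕ} (G : SimpleGraph V) : Prop :=
  (ComputablePred fun x : ℕ => x ∈ V) ∧
    ComputablePred fun p : ℕ × ℕ => ∃ (h₁ : p.1 ∈ V) (h₂ : p.2 ∈ V), G.Adj ⟨p.1, h₁⟩ ⟨p.2, h₂⟩

/-! The vertices of `G` are realised by ceers X_0, X_1, ... (`GenericCeer.column`), the columns of a
single ceer built by a finite injury argument. For each c.e. set of quadruples (x, y, u, v) the
construction tries to collapse x with y, both in one column, while keeping u and v apart, where u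
lies in another column. The outcome, `GenericCeer.generic`, is used twice: each X_i is infinite and
a c.e. set meeting infinitely many of its classes meets all of them (`Good`), and X_i does not
reduce to X_j for i ≠ j. Goodness makes X_i a minimal degree and turns reductions of X_i modulo
finite ceers into plain reductions.

The dark ceer is an amalgam (`Amalgam.rel`). For each pair (i, j) it has a block carrying a copy of
X_i and a copy of X_j. All columns of all blocks share their class of 0, called the zero class
below; if i and j are adjacent, the two columns of the block (i, j) also share their class of 1. So
for an edge there are two ways to join X_i and X_j: with one common class (columns from different
blocks) and with two (the edge block). Both joins are strongly minimal covers, because a c.e. part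
of a join either covers a column or meets it in finitely many classes (`Amalgam.cover_of_columns`).
They are incomparable, because a reduction carries each column onto the column of the same kind, so
the number of common classes is preserved (`Amalgam.incomparable_of_adj`).

To exclude other edges, each block is spread over infinitely many stages. Only one of them,
recognised in the limit, is live; the codes with any other stage belong to the zero class. By
diagonalisation a c.e. set that avoids the zero class meets only finitely many blocks
(`Amalgam.exists_blk_bound`), which together with goodness also gives darkness. An atom below the
amalgam is then represented either by a column or by a thin set, one that meets each block in
finitely many classes. A cover that does not come from an edge block is the union of two such sets
sharing at most the zero class, and reductions between such representatives can be chosen to respect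
the zero class. Hence d and e determine the cover (`Amalgam.exists_adj_of_covers`), so two
incomparable covers force an edge of `G`. All remaining atoms are isolated vertices. -/

section Enumerability

/-! ### Closure properties of c.e. predicates, and uniformisation -/

variable {α β : Type*} [Primcodable α] [Primcodable β]

theorem REPred.exists_stage {p : α → Prop} (hp : REPred p) :
    ∃ q : α × ℕ → Bool, Computable q ∧ ∀ a, p a ↔ ∃ n, q (a, n) = true := by
  obtain ⟨c, hc⟩ := Nat.Partrec.Code.exists_code.1 hp
  refine ⟨fun a => (Nat.Partrec.Code.evaln a.2 c (Encodable.encode a.1)).isSome, ?_, fun a => ?_⟩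
  · exact (Primrec.option_isSome.comp (Nat.Partrec.Code.primrec_evaln.comp
      (Primrec.pair (Primrec.pair Primrec.snd (Primrec.const c))
        (Primrec.encode.comp Primrec.fst)))).to_comp
  · have h : p a ↔ (Nat.Partrec.Code.eval c (Encodable.encode a)).Dom := by
      rw [hc]; simp [Part.assert]
    rw [h, Part.dom_iff_mem]
    simp only [Nat.Partrec.Code.evaln_complete, Option.isSome_iff_exists, Option.mem_def]
    exact exists_comm

theorem REPred.of_stage {p : α → Prop} {q : α × ℕ → Bool} (hq : Computable q)
    (h : ∀ a, p a ↔ ∃ n, q (a, n) = true) : REPred p := by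
  have h1 : Partrec fun a => Nat.rfind (PFun.lift fun n => q (a, n)) :=
    Partrec.rfind (p := fun a => PFun.lift fun n => q (a, n)) hq.partrec
  refine h1.dom_re.of_eq fun a => ?_
  rw [h, Nat.rfind_dom']
  simp

theorem REPred.comp {p : β → Prop} (hp : REPred p) {f : α → β} (hf : Computable f) :
    REPred fun a => p (f a) := by
  obtain ⟨q, hq, h⟩ := hp.exists_stage
  exact REPred.of_stage (q := fun a => q (f a.1, a.2))
    (hq.comp ((hf.comp Computable.fst).pair Computable.snd)) fun a => h (f a)

theorem REPred.exists_nat {p : α × ℕ → Prop} (hp : REPred p) : REPred fun a => ∃ n, p (a, n) := by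
  obtain ⟨q, hq, h⟩ := hp.exists_stage
  refine REPred.of_stage (q := fun a => q ((a.1, a.2.unpair.1), a.2.unpair.2)) (hq.comp ?_)
    fun a => ?_
  · have hu := Primrec.unpair.to_comp.comp (Computable.snd (α := α) (β := ℕ))
    exact (Computable.fst.pair (Computable.fst.comp hu)).pair (Computable.snd.comp hu)
  · constructor
    · rintro ⟨n, hn⟩
      obtain ⟨m, hm⟩ := (h _).1 hn
      exact ⟨Nat.pair n m, by simpa using hm⟩
    · rintro ⟨n, hn⟩
      exact ⟨_, (h _).2 ⟨_, hn⟩⟩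

theorem REPred.and {p q : α → Prop} (hp : REPred p) (hq : REPred q) :
    REPred fun a => p a ∧ q a := by
  obtain ⟨f, hf, h⟩ := hp.exists_stage
  obtain ⟨g, hg, h'⟩ := hq.exists_stage
  refine REPred.of_stage
    (q := fun a => f (a.1, a.2.unpair.1) && g (a.1, a.2.unpair.2)) ?_ fun a => ?_
  · have hu := Primrec.unpair.to_comp.comp (Computable.snd (α := α) (β := ℕ))
    exact Primrec.and.to_comp.comp (hf.comp (Computable.fst.pair (Computable.fst.comp hu)))
      (hg.comp (Computable.fst.pair (Computable.snd.comp hu)))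
  · simp only [h, h', Bool.and_eq_true]
    constructor
    · rintro ⟨⟨n, hn⟩, m, hm⟩
      exact ⟨Nat.pair n m, by simpa using ⟨hn, hm⟩⟩
    · rintro ⟨n, hn, hm⟩
      exact ⟨⟨_, hn⟩, _, hm⟩

theorem REPred.or {p q : α → Prop} (hp : REPred p) (hq : REPred q) :
    REPred fun a => p a ∨ q a := by
  obtain ⟨f, hf, h⟩ := hp.exists_stage
  obtain ⟨g, hg, h'⟩ := hq.exists_stage
  refine REPred.of_stage (q := fun a => f a || g a) (Primrec.or.to_comp.comp hf hg) fun a => ?_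
  simp only [h, h', Bool.or_eq_true, exists_or]

theorem REPred.of_decide {p : α → Prop} [DecidablePred p] (hp : Computable fun a => decide (p a)) :
    REPred p :=
  REPred.of_stage (q := fun a => decide (p a.1)) (hp.comp Computable.fst) fun a => by simp

theorem REPred.of_primrec {p : α → Prop} (hp : PrimrecPred p) : REPred p := by
  classical
  exact REPred.of_decide hp.decide.to_comp

theorem REPred.eq {f g : α → ℕ} (hf : Computable f) (hg : Computable g) :
    REPred fun a => f a = g a :=
  (REPred.of_primrec (p := fun a : ℕ × ℕ => a.1 = a.2)
    (Primrec.eq.comp Primrec.fst Primrec.snd)).comp (hf.pair hg)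

theorem REPred.ne {f g : α → ℕ} (hf : Computable f) (hg : Computable g) :
    REPred fun a => f a ≠ g a :=
  (REPred.of_primrec (p := fun a : ℕ × ℕ => ¬ a.1 = a.2)
    (Primrec.eq.comp Primrec.fst Primrec.snd).not).comp (hf.pair hg)

theorem REPred.true : REPred fun _ : α => True :=
  REPred.of_decide (by simpa using Computable.const Bool.true)

/-- A search over pairs (candidate, stage) stops at the first confirmed candidate. -/
theorem REPred.exists_partial_choice {p : α × ℕ → Prop} (hp : REPred p) :
    ∃ f : α →. ℕ, Partrec f ∧ (∀ a, ∀ n ∈ f a, p (a, n)) ∧ ∀ a, (∃ n, p (a, n)) → (f a).Dom := by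
  obtain ⟨q, hq, hpq⟩ := hp.exists_stage
  have hu := Primrec.unpair.to_comp.comp (Computable.snd (α := α) (β := ℕ))
  have h1 : Partrec fun a => Nat.rfind (PFun.lift fun n => q ((a, n.unpair.1), n.unpair.2)) :=
    Partrec.rfind (p := fun a => PFun.lift fun n => q ((a, n.unpair.1), n.unpair.2))
      (hq.comp ((Computable.fst.pair (Computable.fst.comp hu)).pair
        (Computable.snd.comp hu))).partrec
  refine ⟨_, h1.map (f := fun a => Nat.rfind
    (PFun.lift fun n => q ((a, n.unpair.1), n.unpair.2))) (g := fun _ n => n.unpair.1)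
    (Computable.fst.comp hu), fun a n hn => ?_, fun a ⟨n, hn⟩ => ?_⟩
  · obtain ⟨m, hm, rfl⟩ := (Part.mem_map_iff _).1 hn
    have := Nat.rfind_spec hm
    exact (hpq _).2 ⟨_, (Part.mem_some_iff.1 this).symm⟩
  · obtain ⟨m, hm⟩ := (hpq _).1 hn
    refine (Nat.rfind_dom').2 ?_
    exact ⟨Nat.pair n m, by simpa using hm, by simp⟩

theorem REPred.exists_choice {p : α × ℕ → Prop} (hp : REPred p) (h : ∀ a, ∃ n, p (a, n)) :
    ∃ f : α → ℕ, Computable f ∧ ∀ a, p (a, f a) := by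
  obtain ⟨f, hf, hfp, hd⟩ := hp.exists_partial_choice
  have h2 : Computable fun a => (f a).get (hd a (h a)) := hf.of_eq fun a => by simp
  exact ⟨_, h2, fun a => hfp a _ (Part.get_mem _)⟩

theorem REPred.exists_range {p : ℕ → Prop} (hp : REPred p) (h : ∃ n, p n) :
    ∃ f : ℕ → ℕ, Computable f ∧ (∀ a, p (f a)) ∧ ∀ n, p n → ∃ a, f a = n := by
  obtain ⟨q, hq, hpq⟩ := hp.exists_stage
  obtain ⟨n₀, h₀⟩ := h
  refine ⟨fun a => bif q (a.unpair.1, a.unpair.2) then a.unpair.1 else n₀, ?_, fun a => ?_,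
    fun n hn => ?_⟩
  · have hu := Primrec.unpair.to_comp
    exact Computable.cond (hq.comp ((Computable.fst.comp hu).pair (Computable.snd.comp hu)))
      (Computable.fst.comp hu) (Computable.const n₀)
  · cases hb : q (a.unpair.1, a.unpair.2)
    · beta_reduce; rwa [hb]
    · beta_reduce; rw [hb]; exact (hpq _).2 ⟨_, hb⟩
  · obtain ⟨m, hm⟩ := (hpq _).1 hn
    exact ⟨Nat.pair n m, by simp [hm]⟩

theorem Computable.ite_of_decide {p : α → Prop} [DecidablePred p]
    (hp : Computable fun a => decide (p a)) {f g : α → β} (hf : Computable f) (hg : Computable g) :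
    Computable fun a => if p a then f a else g a :=
  (Computable.cond hp hf hg).of_eq fun a => by by_cases h : p a <;> simp [h]

/-- This gives each c.e. set a requirement number `m`. Convergence for all large `k` allows an
element to be presented again at arbitrarily late stages. -/
theorem REPred.exists_index {p : ℕ → Prop} (hp : REPred p) :
    ∃ m : ℕ, (∀ k w, (Nat.Partrec.Code.evaln k (Denumerable.ofNat _ m) w).isSome → p w) ∧
      ∀ w, p w → ∃ k₀, ∀ k ≥ k₀, (Nat.Partrec.Code.evaln k (Denumerable.ofNat _ m) w).isSome := by
  obtain ⟨c, hc⟩ := Nat.Partrec.Code.exists_code.1 hp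
  have h : ∀ w, p w ↔ (Nat.Partrec.Code.eval c w).Dom := fun w => by
    rw [hc]; simp [Part.assert]
  refine ⟨Encodable.encode c, fun k w hk => ?_, fun w hw => ?_⟩
  · rw [Denumerable.ofNat_encode] at hk
    obtain ⟨x, hx⟩ := Option.isSome_iff_exists.1 hk
    exact (h w).2 (Part.dom_iff_mem.2 ⟨x, Nat.Partrec.Code.evaln_sound hx⟩)
  · obtain ⟨x, hx⟩ := Part.dom_iff_mem.1 ((h w).1 hw)
    obtain ⟨k₀, h₀⟩ := Nat.Partrec.Code.evaln_complete.1 hx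
    refine ⟨k₀, fun k hk => ?_⟩
    rw [Denumerable.ofNat_encode]
    exact Option.isSome_iff_exists.2 ⟨x, Nat.Partrec.Code.evaln_mono hk h₀⟩

end Enumerability

/-! ### The generic ceer: a finite injury construction -/

namespace GenericCeer

/-- The action `(m, s, a, b)` was taken on behalf of requirement `m` at stage `s`; it collapsed the
representative `b` to the smaller representative `a`. -/
abbrev Action := ℕ × ℕ × ℕ × ℕ

/-- The representative of the class of `x` after a list of actions, the most recent one first. -/
def rep (L : List Action) (x : ℕ) : ℕ :=
  L.foldr (fun e y => if y = e.2.2.2 then e.2.2.1 else y) x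

/-- Requirement `m` may collapse representatives that are at least `threshold m L`; it has to wait
if this number is `0`. -/
def threshold (m : ℕ) (L : List Action) : ℕ :=
  L.foldr (fun e t => if e.1 < m then Nat.pair e.2.1 (e.2.1 + 1) + 1 else if e.1 = m then 0 else t) 1

/-- The requirement to which stage `s` is devoted. -/
def req (s : ℕ) : ℕ := s.unpair.1

/-- The quadruple considered at stage `s`. -/
def quad (s : ℕ) : ℕ := s.unpair.2.unpair.2

/-- The first component of a quadruple. -/
def fst (w : ℕ) : ℕ := w.unpair.1.unpair.1
/-- The second component of a quadruple. -/
def snd (w : ℕ) : ℕ := w.unpair.1.unpair.2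
/-- The third component of a quadruple. -/
def thd (w : ℕ) : ℕ := w.unpair.2.unpair.1
/-- The fourth component of a quadruple. -/
def fth (w : ℕ) : ℕ := w.unpair.2.unpair.2

/-- The smaller representative at stage `s`. -/
def lo (L : List Action) (s : ℕ) : ℕ := min (rep L (fst (quad s))) (rep L (snd (quad s)))

/-- The larger representative at stage `s`. -/
def hi (L : List Action) (s : ℕ) : ℕ := max (rep L (fst (quad s))) (rep L (snd (quad s)))

/-- The condition for an action at stage `s`. -/
def Enabled (L : List Action) (s : ℕ) : Prop :=
  (Nat.Partrec.Code.evaln s.unpair.2.unpair.1 (Denumerable.ofNat _ (req s)) (quad s)).isSome = true ∧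
  ((fst (quad s)).unpair.1 = (snd (quad s)).unpair.1 ∧
    ¬ (thd (quad s)).unpair.1 = (fst (quad s)).unpair.1) ∧
  (¬ rep L (fst (quad s)) = rep L (snd (quad s)) ∧ ¬ rep L (thd (quad s)) = rep L (fth (quad s))) ∧
  (¬ threshold (req s) L = 0 ∧ threshold (req s) L ≤ hi L s) ∧ 2 ≤ (hi L s).unpair.2

instance (L : List Action) (s : ℕ) : Decidable (Enabled L s) := by
  unfold Enabled; infer_instance

/-- The actions after stage `s`, if `L` is the list of earlier actions. -/
def step (L : List Action) (s : ℕ) : List Action :=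
  if Enabled L s then (req s, s, lo L s, hi L s) :: L else L

/-- The actions taken before stage `s`. -/
def acts : ℕ → List Action
  | 0 => []
  | s + 1 => step (acts s) s

section Computability

theorem primrec_rep : Primrec₂ rep := by
  refine Primrec.list_foldr (g := fun a : List Action × ℕ => a.2)
    (h := fun _ (p : Action × ℕ) => if p.2 = p.1.2.2.2 then p.1.2.2.1 else p.2)
    Primrec.fst Primrec.snd ?_
  have he : Primrec fun a : (List Action × ℕ) × Action × ℕ => a.2.1 :=
    Primrec.fst.comp Primrec.snd
  have hy : Primrec fun a : (List Action × ℕ) × Action × ℕ => a.2.2 :=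
    Primrec.snd.comp Primrec.snd
  have he2 := Primrec.snd.comp (Primrec.snd.comp he)
  exact Primrec.ite (Primrec.eq.comp hy (Primrec.snd.comp he2)) (Primrec.fst.comp he2) hy

theorem primrec_threshold : Primrec₂ threshold := by
  refine Primrec.list_foldr (f := fun a : ℕ × List Action => a.2) (g := fun _ => 1)
    (h := fun a (p : Action × ℕ) => if p.1.1 < a.1 then Nat.pair p.1.2.1 (p.1.2.1 + 1) + 1 else
      if p.1.1 = a.1 then 0 else p.2)
    Primrec.snd (Primrec.const 1) ?_
  have he : Primrec fun a : (ℕ × List Action) × Action × ℕ => a.2.1 :=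
    Primrec.fst.comp Primrec.snd
  have hy : Primrec fun a : (ℕ × List Action) × Action × ℕ => a.2.2 :=
    Primrec.snd.comp Primrec.snd
  have hm : Primrec fun a : (ℕ × List Action) × Action × ℕ => a.1.1 :=
    Primrec.fst.comp Primrec.fst
  have hs := Primrec.fst.comp (Primrec.snd.comp he)
  exact Primrec.ite (Primrec.nat_lt.comp (Primrec.fst.comp he) hm)
    (Primrec.succ.comp (Primrec₂.natPair.comp hs (Primrec.succ.comp hs)))
    (Primrec.ite (Primrec.eq.comp (Primrec.fst.comp he) hm) (Primrec.const 0) hy)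

theorem primrec_left : Primrec fun n : ℕ => n.unpair.1 := Primrec.fst.comp Primrec.unpair

theorem primrec_right : Primrec fun n : ℕ => n.unpair.2 := Primrec.snd.comp Primrec.unpair

theorem primrec_quad : Primrec quad := primrec_right.comp primrec_right
theorem primrec_req : Primrec req := primrec_left
theorem primrec_fst : Primrec fst := primrec_left.comp primrec_left
theorem primrec_snd : Primrec snd := primrec_right.comp primrec_left
theorem primrec_thd : Primrec thd := primrec_left.comp primrec_right
theorem primrec_fth : Primrec fth := primrec_right.comp primrec_right

theorem primrec_lo : Primrec₂ lo :=
  Primrec.nat_min.comp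
    (primrec_rep.comp Primrec.fst (primrec_fst.comp (primrec_quad.comp Primrec.snd)))
    (primrec_rep.comp Primrec.fst (primrec_snd.comp (primrec_quad.comp Primrec.snd)))

theorem primrec_hi : Primrec₂ hi :=
  Primrec.nat_max.comp
    (primrec_rep.comp Primrec.fst (primrec_fst.comp (primrec_quad.comp Primrec.snd)))
    (primrec_rep.comp Primrec.fst (primrec_snd.comp (primrec_quad.comp Primrec.snd)))

theorem primrecPred_enabled : PrimrecPred fun a : List Action × ℕ => Enabled a.1 a.2 := by
  have hL : Primrec fun a : List Action × ℕ => a.1 := Primrec.fst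
  have hs : Primrec fun a : List Action × ℕ => a.2 := Primrec.snd
  have hq := primrec_quad.comp hs
  have h1 := primrec_fst.comp hq
  have h2 := primrec_snd.comp hq
  have h3 := primrec_thd.comp hq
  have h4 := primrec_fth.comp hq
  have hm := primrec_req.comp hs
  have ht := primrec_threshold.comp hm hL
  have hh : Primrec fun a : List Action × ℕ => hi a.1 a.2 := primrec_hi.comp hL hs
  have he : PrimrecPred fun a : List Action × ℕ => (Nat.Partrec.Code.evaln a.2.unpair.2.unpair.1
      (Denumerable.ofNat _ (req a.2)) (quad a.2)).isSome = true :=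
    Primrec.eq.comp (Primrec.option_isSome.comp (Nat.Partrec.Code.primrec_evaln.comp
      (Primrec.pair (Primrec.pair (primrec_left.comp (primrec_right.comp hs))
        ((Primrec.ofNat _).comp hm)) hq))) (Primrec.const true)
  exact he.and (((Primrec.eq.comp (primrec_left.comp h1) (primrec_left.comp h2)).and
    (Primrec.eq.comp (primrec_left.comp h3) (primrec_left.comp h1)).not).and
    (((Primrec.eq.comp (primrec_rep.comp hL h1) (primrec_rep.comp hL h2)).not.and
      (Primrec.eq.comp (primrec_rep.comp hL h3) (primrec_rep.comp hL h4)).not).and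
    (((Primrec.eq.comp ht (Primrec.const 0)).not.and (Primrec.nat_le.comp ht hh)).and
      (Primrec.nat_le.comp (Primrec.const 2) (primrec_right.comp hh)))))

theorem primrec_step : Primrec₂ step := by
  have hL : Primrec fun a : List Action × ℕ => a.1 := Primrec.fst
  have hs : Primrec fun a : List Action × ℕ => a.2 := Primrec.snd
  have hc : Primrec fun a : List Action × ℕ =>
      ((req a.2, a.2, lo a.1 a.2, hi a.1 a.2) :: a.1 : List Action) :=
    Primrec.list_cons.comp ((primrec_req.comp hs).pair (hs.pair
      ((primrec_lo.comp hL hs).pair (primrec_hi.comp hL hs)))) hL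
  exact Primrec.ite primrecPred_enabled hc hL

theorem acts_eq (n : ℕ) : acts n = Nat.rec [] (fun s L => step L s) n := by
  induction n with
  | zero => rfl
  | succ n ih => rw [acts, ih]

theorem primrec_acts : Primrec acts :=
  (Primrec.nat_rec₁ [] primrec_step.swap).of_eq fun n => (acts_eq n).symm

end Computability

theorem rep_cons (e : Action) (L : List Action) (x : ℕ) :
    rep (e :: L) x = if rep L x = e.2.2.2 then e.2.2.1 else rep L x := rfl

theorem threshold_cons (m : ℕ) (e : Action) (L : List Action) :
    threshold m (e :: L) = if e.1 < m then Nat.pair e.2.1 (e.2.1 + 1) + 1 else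
      if e.1 = m then 0 else threshold m L := rfl

/-- Requirement `m` acts at stage `s`. -/
def ActsAt (m s : ℕ) : Prop := Enabled (acts s) s ∧ req s = m

theorem acts_succ_of_actsAt {m s : ℕ} (h : ActsAt m s) :
    acts (s + 1) = (m, s, lo (acts s) s, hi (acts s) s) :: acts s := by
  obtain ⟨h, rfl⟩ := h
  simp [acts, step, h]

theorem acts_succ_of_not {s : ℕ} (h : ∀ m, ¬ ActsAt m s) : acts (s + 1) = acts s := by
  have : ¬ Enabled (acts s) s := fun h' => h _ ⟨h', rfl⟩
  simp [acts, step, this]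

theorem rep_succ (s x : ℕ) : rep (acts (s + 1)) x =
    if Enabled (acts s) s ∧ rep (acts s) x = hi (acts s) s then lo (acts s) s
    else rep (acts s) x := by
  by_cases h : Enabled (acts s) s
  · simp [acts_succ_of_actsAt ⟨h, rfl⟩, rep_cons, h]
  · simp [acts, step, h]

theorem rep_succ_le (s x : ℕ) : rep (acts (s + 1)) x ≤ rep (acts s) x := by
  rw [rep_succ]
  split_ifs with h
  · rw [h.2]; exact min_le_max
  · rfl

theorem rep_antitone (x : ℕ) : Antitone fun s => rep (acts s) x :=
  antitone_nat_of_succ_le fun s => rep_succ_le s x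

theorem rep_le (s x : ℕ) : rep (acts s) x ≤ x := rep_antitone x (Nat.zero_le s)

theorem rep_column (s x : ℕ) : (rep (acts s) x).unpair.1 = x.unpair.1 := by
  induction s generalizing x with
  | zero => rfl
  | succ s ih =>
    rw [rep_succ]
    split_ifs with h
    · rw [← ih x, h.2, lo, hi]
      have : (rep (acts s) (fst (quad s))).unpair.1 = (rep (acts s) (snd (quad s))).unpair.1 := by
        rw [ih, ih]; exact h.1.2.1.1
      rcases le_total (rep (acts s) (fst (quad s))) (rep (acts s) (snd (quad s))) with h' | h' <;>
        simp [h', this]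
    · exact ih x

theorem quad_le (s : ℕ) : quad s ≤ s := (Nat.unpair_right_le _).trans (Nat.unpair_right_le _)
theorem fst_le (s : ℕ) : fst s ≤ s := (Nat.unpair_left_le _).trans (Nat.unpair_left_le _)
theorem snd_le (s : ℕ) : snd s ≤ s := (Nat.unpair_right_le _).trans (Nat.unpair_left_le _)
theorem thd_le (s : ℕ) : thd s ≤ s := (Nat.unpair_left_le _).trans (Nat.unpair_right_le _)
theorem fth_le (s : ℕ) : fth s ≤ s := (Nat.unpair_right_le _).trans (Nat.unpair_right_le _)

theorem hi_le (s : ℕ) : hi (acts s) s ≤ s :=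
  max_le ((rep_le _ _).trans ((fst_le _).trans (quad_le s)))
    ((rep_le _ _).trans ((snd_le _).trans (quad_le s)))

/-- The number dropped at stage `s` is at most `s`, since the quadruple considered there is coded
inside `s`. -/
theorem rep_of_le {s x : ℕ} (h : s ≤ x) : rep (acts s) x = x := by
  induction s with
  | zero => rfl
  | succ s ih =>
    rw [rep_succ, ih (by omega), if_neg]
    rintro ⟨-, h'⟩
    have := hi_le s
    omega

theorem rep_eq_mono {s t x y : ℕ} (hst : s ≤ t) (h : rep (acts s) x = rep (acts s) y) :
    rep (acts t) x = rep (acts t) y := by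
  induction t, hst using Nat.le_induction with
  | base => exact h
  | succ t _ ih => rw [rep_succ, rep_succ, ih]

theorem lo_ne_hi {s : ℕ} (h : Enabled (acts s) s) : lo (acts s) s ≠ hi (acts s) s := by
  have := h.2.2.1.1
  unfold lo hi
  omega

theorem rep_rep (s x : ℕ) : rep (acts s) (rep (acts s) x) = rep (acts s) x := by
  induction s generalizing x with
  | zero => rfl
  | succ s ih =>
    have h2 : rep (acts s) (lo (acts s) s) = lo (acts s) s := by
      unfold lo
      rcases min_choice (rep (acts s) (fst (quad s))) (rep (acts s) (snd (quad s))) with h | h <;>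
        rw [h, ih]
    by_cases h : Enabled (acts s) s ∧ rep (acts s) x = hi (acts s) s
    · rw [rep_succ s x, if_pos h, rep_succ, h2, if_neg fun h' => lo_ne_hi h.1 h'.2]
    · rw [rep_succ s x, if_neg h, rep_succ, ih, if_neg h]

/-- The ceer that is the limit of the construction. -/
def rel : Setoid ℕ where
  r x y := ∃ s, rep (acts s) x = rep (acts s) y
  iseqv := ⟨fun _ => ⟨0, rfl⟩, fun ⟨s, h⟩ => ⟨s, h.symm⟩, fun ⟨s, h⟩ ⟨t, h'⟩ =>
    ⟨max s t, (rep_eq_mono (le_max_left s t) h).trans (rep_eq_mono (le_max_right s t) h')⟩⟩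

theorem rel_re : REPred fun p : ℕ × ℕ => rel p.1 p.2 := by
  have h : PrimrecPred fun a : (ℕ × ℕ) × ℕ => rep (acts a.2) a.1.1 = rep (acts a.2) a.1.2 :=
    Primrec.eq.comp
      (primrec_rep.comp (primrec_acts.comp Primrec.snd) (Primrec.fst.comp Primrec.fst))
      (primrec_rep.comp (primrec_acts.comp Primrec.snd) (Primrec.snd.comp Primrec.fst))
  exact (REPred.of_primrec h).exists_nat

end GenericCeer

/-! ### Injury, permanent representatives and genericity -/

namespace GenericCeer

theorem ActsAt.threshold_ne_zero {m s : ℕ} (h : ActsAt m s) : threshold m (acts s) ≠ 0 := by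
  obtain ⟨h, rfl⟩ := h
  exact h.2.2.2.1.1

theorem ActsAt.threshold_le_hi {m s : ℕ} (h : ActsAt m s) :
    threshold m (acts s) ≤ hi (acts s) s := by
  obtain ⟨h, rfl⟩ := h
  exact h.2.2.2.1.2

theorem threshold_succ_of_not {m s : ℕ} (h : ∀ m' ≤ m, ¬ ActsAt m' s) :
    threshold m (acts (s + 1)) = threshold m (acts s) := by
  by_cases h' : ∃ m', ActsAt m' s
  · obtain ⟨m', hm'⟩ := h'
    have : ¬ m' ≤ m := fun hle => h m' hle hm'
    rw [acts_succ_of_actsAt hm', threshold_cons, if_neg, if_neg]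
    · dsimp only; omega
    · dsimp only; omega
  · rw [acts_succ_of_not fun m' hm' => h' ⟨m', hm'⟩]

theorem threshold_succ_self {m s : ℕ} (h : ActsAt m s) : threshold m (acts (s + 1)) = 0 := by
  rw [acts_succ_of_actsAt h, threshold_cons]; simp

theorem threshold_succ_of_lt {m m' s : ℕ} (h : ActsAt m s) (hm : m < m') :
    threshold m' (acts (s + 1)) = Nat.pair s (s + 1) + 1 := by
  rw [acts_succ_of_actsAt h, threshold_cons]; simp [hm]

theorem threshold_eq_zero {m s t : ℕ} (h : ActsAt m s) (hs : ∀ t > s, ∀ m' < m, ¬ ActsAt m' t)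
    (ht : s < t) : threshold m (acts t) = 0 := by
  induction t, ht using Nat.le_induction with
  | base => exact threshold_succ_self h
  | succ t hst ih =>
    rw [threshold_succ_of_not, ih]
    intro m' hm' h'
    rcases hm'.lt_or_eq with hlt | rfl
    · exact hs t hst m' hlt h'
    · exact h'.threshold_ne_zero ih

/-- Finite injury: once the requirements below `m` are quiet, an action of `m` sets its threshold to
`0` for good, so `m` acts at most once more. -/
theorem eventually_not_actsAt (m : ℕ) : ∃ s₀, ∀ s ≥ s₀, ∀ m' ≤ m, ¬ ActsAt m' s := by
  induction m using Nat.strong_induction_on with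
  | _ m ih =>
    have h1 : ∃ s₁, ∀ s ≥ s₁, ∀ m' < m, ¬ ActsAt m' s := by
      cases m with
      | zero => exact ⟨0, fun s _ m' h => absurd h (Nat.not_lt_zero _)⟩
      | succ m =>
        obtain ⟨s₀, h⟩ := ih m (Nat.lt_succ_self m)
        exact ⟨s₀, fun s hs m' hm' => h s hs m' (Nat.le_of_lt_succ hm')⟩
    obtain ⟨s₁, h1⟩ := h1
    by_cases h : ∃ s ≥ s₁, ActsAt m s
    · obtain ⟨s, hs, hact⟩ := h
      refine ⟨s + 1, fun t ht m' hm' h' => ?_⟩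
      rcases hm'.lt_or_eq with hlt | rfl
      · exact h1 t (by omega) m' hlt h'
      · exact h'.threshold_ne_zero (threshold_eq_zero hact (fun t ht => h1 t (by omega)) ht)
    · push Not at h
      refine ⟨s₁, fun t ht m' hm' h' => ?_⟩
      rcases hm'.lt_or_eq with hlt | rfl
      · exact h1 t ht m' hlt h'
      · exact h t ht h'

/-- An action of `m` at `s` restrains all weaker requirements below `Nat.pair s (s + 1)`. This bound
exceeds `s`, hence protects the numbers used at `s`, and it also protects one fresh number `Nat.pair
i (s + 1)` in each column `i ≤ s`. -/
theorem lt_threshold {m m' s t : ℕ} (h : ActsAt m s) (hm : m < m') (ht : s < t) :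
    threshold m' (acts t) = 0 ∨ Nat.pair s (s + 1) < threshold m' (acts t) := by
  induction t, ht using Nat.le_induction with
  | base => right; rw [threshold_succ_of_lt h hm]; exact Nat.lt_succ_self _
  | succ t hst ih =>
    by_cases h' : ∃ n ≤ m', ActsAt n t
    · obtain ⟨n, hn, hact⟩ := h'
      rcases hn.lt_or_eq with hlt | rfl
      · right
        rw [threshold_succ_of_lt hact hlt]
        have : Nat.pair s (s + 1) < Nat.pair t (t + 1) :=
          (Nat.pair_lt_pair_left _ hst).trans (Nat.pair_lt_pair_right _ (by omega))
        omega
      · exact Or.inl (threshold_succ_self hact)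
    · push Not at h'
      rwa [threshold_succ_of_not h']

/-- A representative that is small when `m` acts for the last time is never dropped. -/
theorem rep_eq_self_of_actsAt {m s t x : ℕ} (h : ActsAt m s)
    (hs : ∀ t > s, ∀ m' ≤ m, ¬ ActsAt m' t) (hx : x ≤ Nat.pair s (s + 1))
    (hr : rep (acts (s + 1)) x = x) (ht : s < t) : rep (acts t) x = x := by
  induction t, ht using Nat.le_induction with
  | base => exact hr
  | succ t hst ih =>
    rw [rep_succ, ih, if_neg]
    rintro ⟨hen, heq⟩
    have hact : ActsAt (req t) t := ⟨hen, rfl⟩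
    have hlt : m < req t := by
      by_contra hle
      exact hs t hst _ (by omega) hact
    rcases lt_threshold h hlt hst with h0 | h0
    · exact hact.threshold_ne_zero h0
    · have := hact.threshold_le_hi
      omega

/-- `x` is never dropped as a representative. -/
def Permanent (x : ℕ) : Prop := ∀ s, rep (acts s) x = x

theorem permanent_of {x s₀ : ℕ} (h : ∀ s ≥ s₀, rep (acts s) x = x) : Permanent x := fun s =>
  le_antisymm (rep_le s x) (by
    rw [← h (max s s₀) (le_max_right _ _)]
    exact rep_antitone x (le_max_left _ _) |>.trans (by rw [h (max s s₀) (le_max_right _ _)]))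

/-- Among the requirements acting after `max i N` take the strongest, and let `s` be the stage of
its last action. Then `Nat.pair i (s + 1)` is still a representative and is protected from then on.
If no requirement acts that late, any larger number of the column works. -/
theorem exists_permanent (i N : ℕ) : ∃ x, N < x ∧ x.unpair.1 = i ∧ Permanent x := by
  set s₁ := max i N
  by_cases h : ∃ m, ∃ s ≥ s₁, ActsAt m s
  · classical
    have hm := Nat.find_spec h
    have hmin := fun {m'} => Nat.find_min h (m := m')
    set m := Nat.find h
    obtain ⟨s₀, hs₀⟩ := eventually_not_actsAt m
    obtain ⟨s, hs, hact, hlast⟩ : ∃ s ≥ s₁, ActsAt m s ∧ ∀ t > s, ¬ ActsAt m t := by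
      by_contra hcon
      push Not at hcon
      have key : ∀ n, ∃ s ≥ s₁, n ≤ s ∧ ActsAt m s := by
        intro n
        induction n with
        | zero => obtain ⟨s, hs, hact⟩ := hm; exact ⟨s, hs, Nat.zero_le _, hact⟩
        | succ n ih =>
          obtain ⟨s, hs, hn, hact⟩ := ih
          obtain ⟨t, ht, hact'⟩ := hcon s hs hact
          exact ⟨t, by omega, by omega, hact'⟩
      obtain ⟨s, -, hs, hact⟩ := key s₀
      exact hs₀ s hs m le_rfl hact
    have hgt : s + 1 ≤ Nat.pair i (s + 1) := Nat.right_le_pair _ _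
    refine ⟨Nat.pair i (s + 1), by omega, by simp, permanent_of (s₀ := s + 1) fun t ht => ?_⟩
    refine rep_eq_self_of_actsAt hact (fun t ht m' hm' hact' => ?_) ?_ (rep_of_le hgt) ht
    · rcases hm'.lt_or_eq with hlt | rfl
      · exact hmin hlt ⟨t, by omega, hact'⟩
      · exact hlast t ht hact'
    · rcases (show i ≤ s by omega).lt_or_eq with hlt | heq
      · exact (Nat.pair_lt_pair_left _ hlt).le
      · rw [heq]
  · push Not at h
    have hgt : s₁ + 1 ≤ Nat.pair i (s₁ + 1) := Nat.right_le_pair _ _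
    refine ⟨Nat.pair i (s₁ + 1), by omega, by simp, permanent_of (s₀ := s₁) fun t ht => ?_⟩
    induction t, ht using Nat.le_induction with
    | base => exact rep_of_le (by omega)
    | succ t ht ih => rw [acts_succ_of_not fun m => h m t ht, ih]

/-- The last clause of `Enabled` never drops the first two numbers of a column; they serve later as
the two gluing points. -/
theorem permanent_of_right_lt_two {x : ℕ} (hx : x.unpair.2 < 2) : Permanent x := by
  intro s
  induction s with
  | zero => rfl
  | succ s ih =>
    rw [rep_succ, ih, if_neg]
    rintro ⟨h, heq⟩
    have := h.2.2.2.2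
    rw [← heq] at this
    omega

theorem Permanent.eq_of_rel {x y : ℕ} (hx : Permanent x) (hy : Permanent y) (h : rel x y) :
    x = y := by
  obtain ⟨s, h⟩ := h
  rwa [hx, hy] at h

theorem Permanent.le_of_rel {x y : ℕ} (hx : Permanent x) (h : rel x y) : x ≤ y := by
  obtain ⟨s, h⟩ := h
  rw [hx] at h
  exact h ▸ rep_le s y

theorem rel_column {x y : ℕ} (h : rel x y) : x.unpair.1 = y.unpair.1 := by
  obtain ⟨s, h⟩ := h
  rw [← rep_column s x, h, rep_column]

theorem rel_rep (s x : ℕ) : rel x (rep (acts s) x) := ⟨s, (rep_rep s x).symm⟩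

theorem exists_actsAt_of_threshold_eq_zero {m s : ℕ} (h : threshold m (acts s) = 0) :
    ∃ t < s, ActsAt m t ∧ ∀ t', t < t' → t' < s → ∀ m' ≤ m, ¬ ActsAt m' t' := by
  induction s with
  | zero => simp [acts, threshold] at h
  | succ s ih =>
    by_cases h' : ∃ n ≤ m, ActsAt n s
    · obtain ⟨n, hn, hact⟩ := h'
      rcases hn.lt_or_eq with hlt | rfl
      · rw [threshold_succ_of_lt hact hlt] at h; omega
      · exact ⟨s, Nat.lt_succ_self s, hact, fun t' h1 h2 => by omega⟩
    · push Not at h'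
      rw [threshold_succ_of_not h'] at h
      obtain ⟨t, hts, hact, hlast⟩ := ih h
      refine ⟨t, by omega, hact, fun t' h1 h2 m' hm' => ?_⟩
      rcases (show t' ≤ s by omega).lt_or_eq with hlt | rfl
      · exact hlast t' h1 hlt m' hm'
      · exact h' m' hm'

theorem ActsAt.rel {m s : ℕ} (h : ActsAt m s) : rel (fst (quad s)) (snd (quad s)) := by
  refine ⟨s + 1, ?_⟩
  rw [rep_succ, rep_succ]
  have hlo : lo (acts s) s = rep (acts s) (fst (quad s)) ∨
      lo (acts s) s = rep (acts s) (snd (quad s)) := min_choice _ _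
  have hhi : hi (acts s) s = rep (acts s) (fst (quad s)) ∨
      hi (acts s) s = rep (acts s) (snd (quad s)) := max_choice _ _
  have := lo_ne_hi h.1
  simp only [h.1, true_and]
  split_ifs <;> omega

/-- The action itself keeps the last two entries apart: the third lies outside the column being
collapsed, so its representative is neither `lo` nor `hi`. Afterwards the restraint makes both
representatives permanent. -/
theorem ActsAt.not_rel {m s : ℕ} (h : ActsAt m s) (hs : ∀ t > s, ∀ m' ≤ m, ¬ ActsAt m' t) :
    ¬ GenericCeer.rel (thd (quad s)) (fth (quad s)) := by
  have hne : rep (acts (s + 1)) (thd (quad s)) ≠ rep (acts (s + 1)) (fth (quad s)) := by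
    have hcol : ∀ y, (y = lo (acts s) s ∨ y = hi (acts s) s) →
        rep (acts s) (thd (quad s)) ≠ y := by
      rintro y hy h'
      have hy' : y = rep (acts s) (fst (quad s)) ∨ y = rep (acts s) (snd (quad s)) := by
        rcases hy with rfl | rfl
        exacts [min_choice _ _, max_choice _ _]
      apply h.1.2.1.2
      have h1 : (thd (quad s)).unpair.1 = y.unpair.1 := by rw [← h', rep_column]
      rw [h1]
      rcases hy' with rfl | rfl
      · rw [rep_column]
      · rw [rep_column]; exact h.1.2.1.1.symm
    rw [rep_succ, rep_succ, if_neg fun h' => hcol _ (Or.inr rfl) h'.2]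
    split_ifs with h'
    · exact hcol _ (Or.inl rfl)
    · exact h.1.2.2.1.2
  have key : ∀ x ≤ s, Permanent (rep (acts (s + 1)) x) := fun x hx =>
    permanent_of (s₀ := s + 1) fun t ht => rep_eq_self_of_actsAt h hs
      ((rep_le _ _).trans (hx.trans (Nat.left_le_pair _ _))) (rep_rep _ _) ht
  intro hrel
  refine hne ((key _ ((thd_le _).trans (quad_le s))).eq_of_rel
    (key _ ((fth_le _).trans (quad_le s))) ?_)
  exact GenericCeer.rel.trans (GenericCeer.rel.symm (rel_rep _ _))
    (GenericCeer.rel.trans hrel (rel_rep _ _))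

/-- If the requirement of `S` ends in the satisfied state (threshold `0`), its last action gives the
first alternative. Otherwise its threshold settles at a positive value, and an unbounded
counterexample to the second alternative would make it act again. -/
theorem generic {S : ℕ → Prop} (hS : REPred S) (i : ℕ) :
    (∃ w, S w ∧ rel (fst w) (snd w) ∧ ¬ rel (thd w) (fth w)) ∨
    ∃ N, ∀ w, S w → (fst w).unpair.1 = i → (snd w).unpair.1 = i → (thd w).unpair.1 ≠ i →
      rel (fst w) (snd w) ∨ rel (thd w) (fth w) ∨ ∃ n ≤ N, rel (fst w) n := by
  obtain ⟨m, hm, hm'⟩ := hS.exists_index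
  obtain ⟨s₀, hs₀⟩ := eventually_not_actsAt m
  by_cases h0 : threshold m (acts s₀) = 0
  · left
    obtain ⟨s, hs, hact, hlast⟩ := exists_actsAt_of_threshold_eq_zero h0
    refine ⟨quad s, ?_, hact.rel, hact.not_rel fun t ht m' hm'' => ?_⟩
    · have := hact.1.1
      rw [hact.2] at this
      exact hm _ _ this
    · rcases lt_or_ge t s₀ with hlt | hge
      · exact hlast t ht hlt m' hm''
      · exact hs₀ t hge m' hm''
  · right
    have hT : ∀ s ≥ s₀, threshold m (acts s) = threshold m (acts s₀) := by
      intro s hs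
      induction s, hs using Nat.le_induction with
      | base => rfl
      | succ s hs ih => rw [threshold_succ_of_not (hs₀ s hs), ih]
    -- Above this bound neither the threshold nor the protection of the two least numbers of column
    -- `i` blocks an action.
    refine ⟨max (threshold m (acts s₀)) (Nat.pair i 2), fun w hw h1 h2 h3 => ?_⟩
    obtain ⟨k₀, hk₀⟩ := hm' w hw
    -- A stage devoted to `m` and `w`, past `s₀` and with enough computation steps to see `w`
    -- enumerated.
    set s := Nat.pair m (Nat.pair (max s₀ k₀) w) with hs
    have hle : max s₀ k₀ ≤ s := (Nat.left_le_pair _ w).trans (Nat.right_le_pair m _)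
    have hreq : req s = m := by simp [req, hs]
    have hquad : quad s = w := by simp [quad, hs]
    by_contra hcon
    push Not at hcon
    obtain ⟨hc1, hc2, hc3⟩ := hcon
    refine hs₀ s ((le_max_left _ _).trans hle) m le_rfl ⟨⟨?_, ⟨?_, ?_⟩, ⟨?_, ?_⟩, ⟨?_, ?_⟩, ?_⟩, hreq⟩
    · rw [hreq, hquad]
      exact hk₀ _ (by simp [hs])
    · rw [hquad, h1, h2]
    · rw [hquad, h1]; exact h3
    · rw [hquad]; exact fun h => hc1 ⟨s, h⟩
    · rw [hquad]; exact fun h => hc2 ⟨s, h⟩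
    · rw [hreq, hT s ((le_max_left _ _).trans hle)]; exact h0
    · rw [hreq, hT s ((le_max_left _ _).trans hle)]
      by_contra hlt
      refine hc3 (rep (acts s) (fst w)) ?_ (rel_rep s _)
      have := le_max_left (rep (acts s) (fst w)) (rep (acts s) (snd w))
      have h4 := le_max_left (threshold m (acts s₀)) (Nat.pair i 2)
      rw [hi, hquad] at hlt
      omega
    · by_contra hlt
      refine hc3 (rep (acts s) (fst w)) ?_ (rel_rep s _)
      have h4 := le_max_left (rep (acts s) (fst w)) (rep (acts s) (snd w))
      have h5 : (hi (acts s) s).unpair.1 = i := by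
        rw [hi, hquad]
        rcases max_choice (rep (acts s) (fst w)) (rep (acts s) (snd w)) with h | h <;>
          rw [h, rep_column] <;> assumption
      have h6 : hi (acts s) s ≤ Nat.pair i 2 := by
        rw [← Nat.pair_unpair (hi (acts s) s), h5]
        exact (Nat.pair_lt_pair_right _ (by omega)).le
      rw [hi, hquad] at h6
      exact (h4.trans h6).trans (le_max_right _ _)

end GenericCeer

/-- The set `W` meets only finitely many classes of `R`. -/
def FinOver (R : Setoid ℕ) (W : Set ℕ) : Prop := ∃ F : Finset ℕ, ∀ x ∈ W, ∃ y ∈ F, R x y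

/-- `R` has infinitely many classes, and every c.e. set that meets infinitely many of them meets
all of them. -/
def Good (R : Setoid ℕ) : Prop :=
  ¬ FinOver R Set.univ ∧
    ∀ W : Set ℕ, (REPred fun x => x ∈ W) → FinOver R W ∨ ∀ n, ∃ x ∈ W, R n x

/-! ### The columns are good and pairwise incomparable -/

namespace GenericCeer

/-- The restriction of the generic ceer to a column. -/
def column (i : ℕ) : Setoid ℕ := rel.comap (Nat.pair i)

theorem column_iff {i x y : ℕ} : column i x y ↔ rel (Nat.pair i x) (Nat.pair i y) := Iff.rfl

theorem column_re : REPred fun p : ℕ × ℕ × ℕ => column p.1 p.2.1 p.2.2 := by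
  have h1 : Computable fun p : ℕ × ℕ × ℕ => Nat.pair p.1 p.2.1 :=
    (Primrec₂.natPair.comp Primrec.fst (Primrec.fst.comp Primrec.snd)).to_comp
  have h2 : Computable fun p : ℕ × ℕ × ℕ => Nat.pair p.1 p.2.2 :=
    (Primrec₂.natPair.comp Primrec.fst (Primrec.snd.comp Primrec.snd)).to_comp
  exact rel_re.comp (h1.pair h2)

theorem not_column_zero_one (i : ℕ) : ¬ column i 0 1 := by
  intro h
  have := (permanent_of_right_lt_two (x := Nat.pair i 0) (by simp)).eq_of_rel
    (permanent_of_right_lt_two (x := Nat.pair i 1) (by simp)) h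
  simp at this

theorem computable_quadruple {f g h k : ℕ → ℕ} (hf : Computable f) (hg : Computable g)
    (hh : Computable h) (hk : Computable k) :
    Computable fun x => Nat.pair (Nat.pair (f x) (g x)) (Nat.pair (h x) (k x)) :=
  Primrec₂.natPair.to_comp.comp (Primrec₂.natPair.to_comp.comp hf hg)
    (Primrec₂.natPair.to_comp.comp hh hk)

theorem computable_pair_left (i : ℕ) : Computable (Nat.pair i) :=
  (Primrec₂.natPair.comp (Primrec.const i) Primrec.id).to_comp

theorem good_column (i : ℕ) : Good (column i) := by
  refine ⟨?_, fun W hW => ?_⟩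
  · rintro ⟨F, hF⟩
    obtain ⟨x, hx, rfl, hp⟩ := exists_permanent i (F.sup (Nat.pair i))
    obtain ⟨y, hy, hxy⟩ := hF x.unpair.2 trivial
    rw [column_iff, Nat.pair_unpair] at hxy
    have h1 := hp.le_of_rel hxy
    have h2 := Finset.le_sup (f := Nat.pair x.unpair.1) hy
    omega
  · refine or_iff_not_imp_right.2 fun hn => ?_
    push Not at hn
    obtain ⟨n, hn⟩ := hn
    -- If `W` misses the class of `n`, try to collapse `n` with elements of `W`. The pair to keep
    -- apart is a dummy, `0` and `1` of the next column, which are never equivalent. Success is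
    -- impossible, so `W` meets finitely many classes.
    have hq : Computable fun x => Nat.pair (Nat.pair (Nat.pair i x) (Nat.pair i n))
        (Nat.pair (Nat.pair (i + 1) 0) (Nat.pair (i + 1) 1)) :=
      computable_quadruple (computable_pair_left i) (Computable.const _) (Computable.const _)
        (Computable.const _)
    have hS : REPred fun w => ∃ x, x ∈ W ∧ w = Nat.pair (Nat.pair (Nat.pair i x) (Nat.pair i n))
        (Nat.pair (Nat.pair (i + 1) 0) (Nat.pair (i + 1) 1)) :=
      REPred.exists_nat (p := fun a : ℕ × ℕ => a.2 ∈ W ∧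
        a.1 = Nat.pair (Nat.pair (Nat.pair i a.2) (Nat.pair i n))
        (Nat.pair (Nat.pair (i + 1) 0) (Nat.pair (i + 1) 1)))
        ((hW.comp Computable.snd).and (REPred.eq Computable.fst (hq.comp Computable.snd)))
    rcases generic hS i with ⟨w, ⟨x, hx, rfl⟩, h, -⟩ | ⟨N, hN⟩
    · simp only [fst, snd, Nat.unpair_pair] at h
      exact absurd ((column i).symm h) (hn x hx)
    · refine ⟨Finset.range (N + 1), fun x hx => ?_⟩
      have := hN _ ⟨x, hx, rfl⟩ (by simp [fst]) (by simp [snd]) (by simp [thd])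
      simp only [fst, snd, thd, fth, Nat.unpair_pair] at this
      rcases this with h | h | ⟨m, hm, h⟩
      · exact absurd ((column i).symm h) (hn x hx)
      · exact absurd h (not_column_zero_one (i + 1))
      · have h1 := rel_column h
        rw [Nat.unpair_pair] at h1
        refine ⟨m.unpair.2, ?_, ?_⟩
        · have := Nat.unpair_right_le m
          simp; omega
        · rw [column_iff]
          convert h
          rw [show i = m.unpair.1 from h1, Nat.pair_unpair]

/-- Genericity is applied to the quadruples consisting of two points of column `i` and their images
under `f` in column `j`. Success refutes the reduction; failure is refuted by two large permanent
representatives. -/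
theorem not_compReducible_column {i j : ℕ} (hij : i ≠ j) :
    ¬ CompReducible (column i) (column j) := by
  rintro ⟨f, hf, hred⟩
  have hl : Computable fun x : ℕ => Nat.pair i x.unpair.1 :=
    (computable_pair_left i).comp primrec_left.to_comp
  have hr : Computable fun x : ℕ => Nat.pair i x.unpair.2 :=
    (computable_pair_left i).comp primrec_right.to_comp
  have hq : Computable fun x : ℕ => Nat.pair (Nat.pair (Nat.pair i x.unpair.1) (Nat.pair i x.unpair.2))
        (Nat.pair (Nat.pair j (f x.unpair.1)) (Nat.pair j (f x.unpair.2))) :=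
    computable_quadruple hl hr ((computable_pair_left j).comp (hf.comp primrec_left.to_comp))
        ((computable_pair_left j).comp (hf.comp primrec_right.to_comp))
  have hS : REPred fun w => ∃ x : ℕ,
      w = Nat.pair (Nat.pair (Nat.pair i x.unpair.1) (Nat.pair i x.unpair.2))
        (Nat.pair (Nat.pair j (f x.unpair.1)) (Nat.pair j (f x.unpair.2))) :=
    REPred.exists_nat (p := fun a : ℕ × ℕ => a.1 = _)
      (REPred.eq Computable.fst (hq.comp Computable.snd))
  rcases generic hS i with ⟨w, ⟨x, rfl⟩, h, h'⟩ | ⟨N, hN⟩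
  · simp only [fst, snd, thd, fth, Nat.unpair_pair] at h h'
    exact h' ((hred _ _).1 h)
  · obtain ⟨x, hx, hxi, hxp⟩ := exists_permanent i N
    obtain ⟨y, hy, hyi, hyp⟩ := exists_permanent i x
    have := hN _ ⟨Nat.pair x.unpair.2 y.unpair.2, rfl⟩ (by simp [fst]) (by simp [snd])
      (by simpa [thd] using hij.symm)
    simp only [fst, snd, thd, fth, Nat.unpair_pair] at this
    have hne : ¬ rel (Nat.pair i x.unpair.2) (Nat.pair i y.unpair.2) := by
      intro h
      rw [← hxi, Nat.pair_unpair, hxi, ← hyi, Nat.pair_unpair] at h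
      exact hy.ne (hxp.eq_of_rel hyp h)
    rcases this with h | h | ⟨m, hm, h⟩
    · exact hne h
    · exact hne ((hred _ _).2 h)
    · rw [← hxi, Nat.pair_unpair] at h
      have := hxp.le_of_rel h
      omega

end GenericCeer

/-! ### Sets that meet finitely many classes -/

section FinOver

variable {R S : Setoid ℕ} {W W' : Set ℕ}

theorem FinOver.mono (h : FinOver R W') (hW : W ⊆ W') : FinOver R W := by
  obtain ⟨F, hF⟩ := h
  exact ⟨F, fun x hx => hF x (hW hx)⟩

theorem FinOver.union (h : FinOver R W) (h' : FinOver R W') : FinOver R (W ∪ W') := by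
  classical
  obtain ⟨F, hF⟩ := h
  obtain ⟨F', hF'⟩ := h'
  refine ⟨F ∪ F', ?_⟩
  rintro x (hx | hx)
  · obtain ⟨y, hy, h⟩ := hF x hx
    exact ⟨y, Finset.mem_union_left _ hy, h⟩
  · obtain ⟨y, hy, h⟩ := hF' x hx
    exact ⟨y, Finset.mem_union_right _ hy, h⟩

theorem FinOver.of_map (f : ℕ → ℕ) (h : FinOver S W') (hW : ∀ x ∈ W, f x ∈ W')
    (hf : ∀ x ∈ W, ∀ y ∈ W, S (f x) (f y) → R x y) : FinOver R W := by
  classical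
  obtain ⟨F, hF⟩ := h
  -- Each class in `F` that is hit contributes one preimage from `W`; the default `0` only adds a
  -- superfluous representative.
  refine ⟨F.image fun y => if h : ∃ x ∈ W, S (f x) y then h.choose else 0, fun x hx => ?_⟩
  obtain ⟨y, hy, hxy⟩ := hF (f x) (hW x hx)
  have hex : ∃ x ∈ W, S (f x) y := ⟨x, hx, hxy⟩
  refine ⟨_, Finset.mem_image_of_mem _ hy, ?_⟩
  rw [dif_pos hex]
  exact hf x hx _ hex.choose_spec.1 (S.trans hxy (S.symm hex.choose_spec.2))

theorem FinOver.of_key (key : ℕ → ℕ) (n : ℕ) (hn : ∀ x ∈ W, key x < n)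
    (hkey : ∀ x ∈ W, ∀ y ∈ W, key x = key y → R x y) : FinOver R W :=
  FinOver.of_map (S := ⊥) (W' := {x | x < n}) key
    ⟨Finset.range n, fun x hx => ⟨x, by simpa using hx, rfl⟩⟩ hn hkey

theorem FinOver.iUnion {n : ℕ} {U : ℕ → Set ℕ} (h : ∀ k < n, FinOver R (U k))
    (hW : ∀ x ∈ W, ∃ k < n, x ∈ U k) : FinOver R W := by
  classical
  choose! F hF using h
  refine ⟨(Finset.range n).biUnion F, fun x hx => ?_⟩
  obtain ⟨k, hk, hxk⟩ := hW x hx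
  obtain ⟨y, hy, hxy⟩ := hF k hk x hxk
  exact ⟨y, Finset.mem_biUnion.2 ⟨k, by simpa using hk, hy⟩, hxy⟩

/-- Pigeonhole: an infinite set that meets finitely many classes contains equivalent elements. -/
theorem FinOver.exists_rel (h : FinOver R W) (hW : W.Infinite) :
    ∃ x ∈ W, ∃ y ∈ W, x ≠ y ∧ R x y := by
  obtain ⟨F, hF⟩ := h
  choose! g hg using hF
  obtain ⟨x, hx, y, hy, hne, heq⟩ :=
    hW.exists_ne_map_eq_of_mapsTo (f := g) (t := ↑F) (fun x hx => (hg x hx).1) F.finite_toSet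
  exact ⟨x, hx, y, hy, hne, R.trans (hg x hx).2 (heq ▸ R.symm (hg y hy).2)⟩

theorem finOver_univ_iff : FinOver R Set.univ ↔ Finite (Quotient R) := by
  classical
  constructor
  · rintro ⟨F, hF⟩
    refine Finite.of_surjective (fun y : F => (Quotient.mk R y.1)) fun q => ?_
    induction q using Quotient.ind with
    | _ x =>
      obtain ⟨y, hy, h⟩ := hF x trivial
      exact ⟨⟨y, hy⟩, Quotient.sound (R.symm h)⟩
  · intro h
    have := Fintype.ofFinite (Quotient R)
    refine ⟨Finset.univ.image (Quotient.out : Quotient R → ℕ), fun x _ =>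
      ⟨_, Finset.mem_image_of_mem _ (Finset.mem_univ (Quotient.mk R x)), ?_⟩⟩
    exact R.symm (Quotient.exact (Quotient.out_eq (Quotient.mk R x)))

end FinOver

/-! ### Reductions modulo finite ceers -/

section Reductions

variable {R S : Setoid ℕ}

theorem uniformJoin_iff (x y : ℕ) : uniformJoin R S x y ↔
    (x % 2 = 0 ∧ y % 2 = 0 ∧ R (x / 2) (y / 2)) ∨ (x % 2 = 1 ∧ y % 2 = 1 ∧ S (x / 2) (y / 2)) := by
  have e (a : ℕ) : (2 * a + 1) / 2 = a := by omega
  rcases Nat.even_or_odd' x with ⟨u, rfl | rfl⟩ <;> rcases Nat.even_or_odd' y with ⟨v, rfl | rfl⟩ <;>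
    simp [uniformJoin_even_even, uniformJoin_even_odd, uniformJoin_odd_even, uniformJoin_odd_odd, e,
      Nat.add_mod]

theorem LeI.exists_map (h : LeI R S) : ∃ (k : ℕ) (f : ℕ → ℕ), Computable f ∧ ∀ x y, R x y ↔
    (f x % 2 = 0 ∧ f y % 2 = 0 ∧ S (f x / 2) (f y / 2)) ∨
      (f x % 2 = 1 ∧ f y % 2 = 1 ∧ f x / 2 % (k + 1) = f y / 2 % (k + 1)) := by
  obtain ⟨k, hk⟩ := h
  obtain ⟨f, hf, h⟩ := compReducible_joinId_succ hk
  exact ⟨k, f, hf, fun x y => (h x y).trans (uniformJoin_iff _ _)⟩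

theorem LeI.of_map {f : ℕ → ℕ} (k : ℕ) (hf : Computable f) (h : ∀ x y, R x y ↔
    (f x % 2 = 0 ∧ f y % 2 = 0 ∧ S (f x / 2) (f y / 2)) ∨
      (f x % 2 = 1 ∧ f y % 2 = 1 ∧ f x / 2 % (k + 1) = f y / 2 % (k + 1))) : LeI R S :=
  ⟨k + 1, f, hf, fun x y => (h x y).trans (uniformJoin_iff (S := idMod (k + 1)) _ _).symm⟩

theorem CompReducible.leI (h : CompReducible R S) : LeI R S := ⟨0, h⟩

theorem compReducible_comap {p : ℕ → ℕ} (hp : Computable p) : CompReducible (R.comap p) R :=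
  ⟨p, hp, fun _ _ => Iff.rfl⟩

theorem computable_div_two : Computable fun n : ℕ => n / 2 :=
  (Primrec.nat_div.comp Primrec.id (Primrec.const 2)).to_comp

theorem computable_even : Computable fun n : ℕ => decide (n % 2 = 0) :=
  (Primrec.eq.comp (Primrec.nat_mod.comp Primrec.id (Primrec.const 2)) (Primrec.const 0)).decide.to_comp

/-- A reduction modulo the finite ceers becomes a plain reduction after finitely many classes have
been removed. -/
theorem LeI.exists_restrict (h : LeI R S) : ∃ r g : ℕ → ℕ, Computable r ∧ Computable g ∧
    (∀ x y, R (r x) (r y) ↔ S (g x) (g y)) ∧ LeI R (R.comap r) := by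
  obtain ⟨k, f, hf, h⟩ := h.exists_map
  -- Inputs sent to the finite part are redirected to `x₀`, which is sent to the `S` part if any
  -- input is. If none is, the redirection is constant and the restriction has a single class.
  obtain ⟨x₀, h₀⟩ : ∃ x₀, (∃ x, f x % 2 = 0) → f x₀ % 2 = 0 := by
    by_cases hx : ∃ x, f x % 2 = 0
    · obtain ⟨x, hx⟩ := hx
      exact ⟨x, fun _ => hx⟩
    · exact ⟨0, fun hx' => absurd hx' hx⟩
  have hr : Computable fun x => if f x % 2 = 0 then x else x₀ :=
    Computable.ite_of_decide (computable_even.comp hf) Computable.id (Computable.const x₀)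
  refine ⟨_, _, hr, computable_div_two.comp (hf.comp hr), fun x y => ?_, LeI.of_map k
    (f := fun x => if f x % 2 = 0 then 2 * x else f x)
    (Computable.ite_of_decide (computable_even.comp hf) Primrec.nat_double.to_comp hf)
    fun x y => ?_⟩
  · by_cases hx : ∃ x, f x % 2 = 0
    · have h0 : ∀ x, f (if f x % 2 = 0 then x else x₀) % 2 = 0 := by
        intro x
        split_ifs with h'
        exacts [h', h₀ hx]
      rw [h]
      simp [h0]
    · push Not at hx
      simp only [hx, if_false]
      exact ⟨fun _ => S.refl _, fun _ => R.refl _⟩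
  · rw [h]
    have e (a : ℕ) : 2 * a % 2 = 0 := by omega
    have e' (a : ℕ) : 2 * a / 2 = a := by omega
    by_cases hx : f x % 2 = 0 <;> by_cases hy : f y % 2 = 0 <;>
      simp only [hx, hy, if_true, if_false, e, e', Setoid.comap_rel]
    · simp [h, hx, hy]
    · simp
    · simp
    · simp

/-- Since `S` is c.e., an equivalent value of `q` can be searched for; comparing c.e. parts of one
ceer thus reduces to inclusion of saturations. -/
theorem CompReducible.of_subset (hS : REPred fun p : ℕ × ℕ => S p.1 p.2) {p q : ℕ → ℕ}
    (hp : Computable p) (hq : Computable q) (h : ∀ x, ∃ y, S (p x) (q y)) :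
    CompReducible (S.comap p) (S.comap q) := by
  obtain ⟨f, hf, h⟩ := REPred.exists_choice (p := fun a : ℕ × ℕ => S (p a.1) (q a.2))
    (hS.comp ((hp.comp Computable.fst).pair (hq.comp Computable.snd))) h
  exact ⟨f, hf, fun x y => ⟨fun hxy => S.trans (S.symm (h x)) (S.trans hxy (h y)),
    fun hxy => S.trans (h x) (S.trans hxy (S.symm (h y)))⟩⟩

theorem LeI.of_finset (hS : REPred fun p : ℕ × ℕ => S p.1 p.2) {p q : ℕ → ℕ}
    (hp : Computable p) (hq : Computable q) (F : Finset ℕ)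
    (h : ∀ x, (∃ y, S (p x) (q y)) ∨ ∃ z ∈ F, S (p x) z) :
    LeI (S.comap p) (S.comap q) := by
  classical
  induction F using Finset.induction_on generalizing q with
  | empty => exact (CompReducible.of_subset hS hp hq fun x => by simpa using h x).leI
  | insert z F _ ih =>
    have hq' : Computable fun n => if n = 0 then z else q (n - 1) :=
      Computable.ite_of_decide (Primrec.eq.comp Primrec.id (Primrec.const 0)).decide.to_comp
        (Computable.const z) (hq.comp Primrec.pred.to_comp)
    refine (ih hq' fun x => ?_).trans (S := S.comap fun n => if n = 0 then z else q (n - 1)) ?_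
    · rcases h x with ⟨y, hy⟩ | ⟨z', hz', hx⟩
      · exact Or.inl ⟨y + 1, by simpa using hy⟩
      · rcases Finset.mem_insert.1 hz' with rfl | hz'
        · exact Or.inl ⟨0, by simpa using hx⟩
        · exact Or.inr ⟨z', hz', hx⟩
    -- Either the class of `z` already occurs in `q`, or it splits off as the single class of `Id_1`
    -- (hence the parameter `0` below).
    · by_cases hz : ∃ y, S z (q y)
      · refine (CompReducible.of_subset hS hq' hq fun x => ?_).leI
        cases x with
        | zero => simpa using hz
        | succ n => exact ⟨n, by simp⟩
      · push Not at hz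
        refine LeI.of_map 0 (f := fun n => if n = 0 then 1 else 2 * (n - 1))
          (Computable.ite_of_decide (Primrec.eq.comp Primrec.id (Primrec.const 0)).decide.to_comp
            (Computable.const 1) (Primrec.nat_double.to_comp.comp Primrec.pred.to_comp))
          fun x y => ?_
        have hz' : ∀ y, ¬ S (q y) z := fun y h => hz y (S.symm h)
        cases x <;> cases y <;> simp [Setoid.comap_rel, hz, hz', Nat.mod_one]

theorem finOver_of_leI_idMod_one (h : LeI R (idMod 1)) : FinOver R Set.univ := by
  obtain ⟨k, f, -, h⟩ := h.exists_map
  refine FinOver.of_key (fun x => if f x % 2 = 0 then 0 else f x / 2 % (k + 1) + 1) (k + 2)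
    (fun x _ => ?_) fun x _ y _ hxy => (h x y).2 ?_
  · have : f x / 2 % (k + 1) < k + 1 := Nat.mod_lt _ (Nat.succ_pos k)
    split_ifs <;> omega
  · by_cases h1 : f x % 2 = 0 <;> by_cases h2 : f y % 2 = 0 <;>
      simp only [h1, h2, if_true, if_false] at hxy
    · exact Or.inl ⟨h1, h2, Nat.modEq_one⟩
    · omega
    · omega
    · exact Or.inr ⟨by omega, by omega, by omega⟩

theorem FinOver.leI_idMod_one (hS : REPred fun p : ℕ × ℕ => S p.1 p.2)
    (h : FinOver S Set.univ) : LeI S (idMod 1) := by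
  obtain ⟨F, hF⟩ := h
  exact (LeI.of_finset hS (p := id) (q := fun _ => 0) Computable.id (Computable.const 0) F
    fun x => Or.inr (hF x trivial)).trans (CompReducible.leI
      ⟨fun _ => 0, Computable.const 0, fun x y => ⟨fun _ => rfl, fun _ => S.refl 0⟩⟩)

theorem re_preimage_even {f : ℕ → ℕ} (hf : Computable f) (a : ℕ) : REPred fun x => f x % 2 = a :=
  (REPred.of_primrec (p := fun x => x % 2 = a) (Primrec.eq.comp
    (Primrec.nat_mod.comp Primrec.id (Primrec.const 2)) (Primrec.const a))).comp hf

theorem Good.forall_even (hR : Good R) {f : ℕ → ℕ} (hf : Computable f)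
    (h : ¬ FinOver R {x | f x % 2 = 0}) : ∀ n, ∃ x, f x % 2 = 0 ∧ R n x :=
  (hR.2 {x | f x % 2 = 0} (re_preimage_even hf 0)).resolve_left h

/-- The inputs sent to the finite part cover finitely many classes, so the others meet every class.
Since equivalent inputs go to the same side, no input is sent to the finite part. -/
theorem Good.map_even (hR : Good R) {k : ℕ} {f : ℕ → ℕ} (hf : Computable f) (h : ∀ x y, R x y ↔
    (f x % 2 = 0 ∧ f y % 2 = 0 ∧ S (f x / 2) (f y / 2)) ∨
      (f x % 2 = 1 ∧ f y % 2 = 1 ∧ f x / 2 % (k + 1) = f y / 2 % (k + 1))) (n : ℕ) :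
    f n % 2 = 0 := by
  have hodd : FinOver R {x | f x % 2 = 1} := by
    refine FinOver.of_key (fun x => f x / 2 % (k + 1)) (k + 1)
      (fun x _ => Nat.mod_lt _ (Nat.succ_pos k)) fun x hx y hy hxy => (h x y).2 ?_
    exact Or.inr ⟨hx, hy, hxy⟩
  obtain ⟨x, hx, hnx⟩ := hR.forall_even hf (fun he => hR.1 ((he.union hodd).mono fun x _ => by
    simp only [Set.mem_union, Set.mem_ofPred_eq]; omega)) n
  rcases (h n x).1 hnx with h1 | h1
  · exact h1.1
  · omega

theorem Good.compReducible (hR : Good R) (h : LeI R S) : CompReducible R S := by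
  obtain ⟨k, f, hf, h⟩ := h.exists_map
  exact ⟨fun x => f x / 2, computable_div_two.comp hf, fun x y => by
    rw [h]; simp [hR.map_even hf h]⟩

end Reductions

/-! ### The amalgam and its live stages -/

namespace Amalgam

open GenericCeer (column primrec_left primrec_right)

section Stages

/-- Whether program `e` has stopped on input `k` with an output below `s` after `s` steps. -/
def halted (e k s : ℕ) : ℕ :=
  Option.casesOn (Nat.Partrec.Code.evaln s (Denumerable.ofNat _ e) k) 0
    fun v => if v < s then 1 else 0

/-- The number of programs `e ≤ k` that have stopped on input `k` after `s` steps. -/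
def count (k s : ℕ) : ℕ := ∑ e ∈ Finset.range (k + 1), halted e k s

theorem halted_eq_one_iff {e k s : ℕ} : halted e k s = 1 ↔
    ∃ v ∈ Nat.Partrec.Code.evaln s (Denumerable.ofNat _ e) k, v < s := by
  unfold halted
  cases Nat.Partrec.Code.evaln s (Denumerable.ofNat _ e) k <;> simp

theorem halted_le_one (e k s : ℕ) : halted e k s ≤ 1 := by
  unfold halted
  cases Nat.Partrec.Code.evaln s (Denumerable.ofNat _ e) k with
  | none => simp
  | some v => dsimp only; split_ifs <;> simp

theorem halted_mono (e k : ℕ) : Monotone (halted e k) := by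
  intro s t hst
  by_cases h : halted e k s = 1
  · obtain ⟨v, hv, hvs⟩ := halted_eq_one_iff.1 h
    rw [h, halted_eq_one_iff.2 ⟨v, Nat.Partrec.Code.evaln_mono hst hv, hvs.trans_le hst⟩]
  · have := halted_le_one e k s
    omega

theorem count_mono (k : ℕ) : Monotone (count k) := fun _ _ hst =>
  Finset.sum_le_sum fun e _ => halted_mono e k hst

theorem primrec_halted : Primrec fun a : ℕ × ℕ × ℕ => halted a.1 a.2.1 a.2.2 := by
  have h1 : Primrec fun a : ℕ × ℕ × ℕ =>
      Nat.Partrec.Code.evaln a.2.2 (Denumerable.ofNat _ a.1) a.2.1 :=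
    Nat.Partrec.Code.primrec_evaln.comp (((Primrec.snd.comp Primrec.snd).pair
      ((Primrec.ofNat _).comp Primrec.fst)).pair (Primrec.fst.comp Primrec.snd))
  refine Primrec.option_casesOn h1 (Primrec.const 0) (g := fun a v => if v < a.2.2 then 1 else 0) ?_
  exact Primrec.ite (Primrec.nat_lt.comp Primrec.snd
    (Primrec.snd.comp (Primrec.snd.comp Primrec.fst))) (Primrec.const 1) (Primrec.const 0)

theorem primrec_count : Primrec₂ count := by
  have hg : Primrec₂ fun (a : ℕ × ℕ) (b : ℕ × ℕ) => b.2 + halted b.1 a.1 a.2 :=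
    Primrec.nat_add.comp (Primrec.snd.comp Primrec.snd)
      (primrec_halted.comp ((Primrec.fst.comp Primrec.snd).pair
        ((Primrec.fst.comp Primrec.fst).pair (Primrec.snd.comp Primrec.fst))))
  have := Primrec.nat_rec' (f := fun a : ℕ × ℕ => a.1 + 1) (g := fun _ => 0)
    (Primrec.succ.comp Primrec.fst) (Primrec.const 0) hg
  refine this.of_eq fun a => ?_
  unfold count
  generalize a.1 + 1 = n
  induction n with
  | zero => rfl
  | succ n ih => rw [Finset.sum_range_succ, ← ih]

/-- `t` is not the first stage at which `count k` has reached its final value. -/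
def NonLive (k t : ℕ) : Prop := ∃ s, (s < t ∧ count k s = count k t) ∨ (t < s ∧ ¬ count k s = count k t)

theorem nonLive_re : REPred fun a : ℕ × ℕ => NonLive a.1 a.2 := by
  have hk : Primrec fun a : (ℕ × ℕ) × ℕ => a.1.1 := Primrec.fst.comp Primrec.fst
  have ht : Primrec fun a : (ℕ × ℕ) × ℕ => a.1.2 := Primrec.snd.comp Primrec.fst
  have hs : Primrec fun a : (ℕ × ℕ) × ℕ => a.2 := Primrec.snd
  have he : PrimrecPred fun a : (ℕ × ℕ) × ℕ => count a.1.1 a.2 = count a.1.1 a.1.2 :=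
    Primrec.eq.comp (primrec_count.comp hk hs) (primrec_count.comp hk ht)
  exact (REPred.of_primrec (((Primrec.nat_lt.comp hs ht).and he).or
    ((Primrec.nat_lt.comp ht hs).and he.not))).exists_nat

theorem exists_live (k : ℕ) : ∃ t, ¬ NonLive k t := by
  classical
  have h : ∃ t, ∀ s ≥ t, count k s = count k t := by
    have hb : ∀ s, count k s ≤ k + 1 := fun s => by
      simpa [count] using Finset.sum_le_card_nsmul (Finset.range (k + 1)) (fun e => halted e k s) 1
        fun e _ => halted_le_one e k s
    -- `count k` is monotone and bounded by `k + 1`, so it is constant from any stage where it is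
    -- maximal.
    refine ⟨Function.argmin fun s => k + 1 - count k s, fun s hs => ?_⟩
    have h1 := Function.argmin_le (fun s => k + 1 - count k s) s
    have h2 := count_mono k hs
    have h3 := hb s
    have h4 := hb (Function.argmin fun s => k + 1 - count k s)
    omega
  refine ⟨Nat.find h, ?_⟩
  rintro ⟨s, ⟨hs, heq⟩ | ⟨hs, hne⟩⟩
  · refine Nat.find_min h hs fun u hu => ?_
    rcases le_total u (Nat.find h) with hle | hle
    · exact le_antisymm ((count_mono k hle).trans heq.ge) (count_mono k hu)
    · rw [Nat.find_spec h u hle, heq]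
  · exact hne (Nat.find_spec h s hs.le)

theorem live_unique {k s t : ℕ} (hs : ¬ NonLive k s) (ht : ¬ NonLive k t) : s = t := by
  wlog h : s < t generalizing s t
  · by_contra hne
    exact hne (this ht hs (by omega)).symm
  · by_contra
    refine ht ⟨s, Or.inl ⟨h, ?_⟩⟩
    by_contra hne
    exact hs ⟨t, Or.inr ⟨h, fun h' => hne h'.symm⟩⟩

/-- The live stage of the block `k`. -/
noncomputable def live (k : ℕ) : ℕ := (exists_live k).choose

theorem not_nonLive_live (k : ℕ) : ¬ NonLive k (live k) := (exists_live k).choose_spec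

end Stages

/-- The equivalence of the columns of the generic ceer, as a relation. -/
@[irreducible] def Col (i x y : ℕ) : Prop := column i x y

theorem col_iff {i x y : ℕ} : Col i x y ↔ column i x y := by rw [Col]

theorem Col.refl (i x : ℕ) : Col i x x := col_iff.2 ((column i).refl x)

theorem Col.symm {i x y : ℕ} (h : Col i x y) : Col i y x := col_iff.2 ((column i).symm (col_iff.1 h))

theorem Col.trans {i x y z : ℕ} (h : Col i x y) (h' : Col i y z) : Col i x z :=
  col_iff.2 ((column i).trans (col_iff.1 h) (col_iff.1 h'))

theorem col_re : REPred fun p : ℕ × ℕ × ℕ => Col p.1 p.2.1 p.2.2 :=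
  GenericCeer.column_re.of_eq fun _ => col_iff.symm

theorem not_col_zero_one (i : ℕ) : ¬ Col i 0 1 := fun h =>
  GenericCeer.not_column_zero_one i (col_iff.1 h)

/-- The block of a code. -/
def blk (n : ℕ) : ℕ := n.unpair.1
/-- The stage of a code. -/
def stg (n : ℕ) : ℕ := n.unpair.2.unpair.1
/-- The side of a code within its block. -/
def side (n : ℕ) : Bool := decide (n.unpair.2.unpair.2 % 2 = 1)
/-- The value of a code. -/
def val (n : ℕ) : ℕ := n.unpair.2.unpair.2 / 2
/-- The index of the generic ceer of which a copy is put on one side of the block `k`. -/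
def kind (k : ℕ) (c : Bool) : ℕ := bif c then k.unpair.2 else k.unpair.1

theorem primrec_blk : Primrec blk := primrec_left
theorem primrec_stg : Primrec stg := primrec_left.comp primrec_right
theorem primrec_val : Primrec val :=
  Primrec.nat_div.comp (primrec_right.comp primrec_right) (Primrec.const 2)
theorem primrec_side : Primrec side := by
  refine PrimrecPred.decide (p := fun n : ℕ => n.unpair.2.unpair.2 % 2 = 1) ?_
  exact Primrec.eq.comp (Primrec.nat_mod.comp (primrec_right.comp primrec_right)
    (Primrec.const 2)) (Primrec.const 1)
theorem primrec_kind : Primrec₂ kind :=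
  Primrec.cond Primrec.snd (primrec_right.comp Primrec.fst) (primrec_left.comp Primrec.fst)

/-- Membership in the class common to all columns. -/
def Zero (n : ℕ) : Prop :=
  NonLive (blk n) (stg n) ∨ Col (kind (blk n) (side n)) (val n) 0

/-- Membership in the second class common to both sides of an edge block. -/
def One (A : ℕ × ℕ → Prop) (n : ℕ) : Prop :=
  A (blk n).unpair ∧ Col (kind (blk n) (side n)) (val n) 1

/-- The equivalence of the amalgam, as a relation. -/
def Rel (A : ℕ × ℕ → Prop) (m n : ℕ) : Prop :=
  (Zero m ∧ Zero n) ∨ (blk m = blk n ∧ stg m = stg n ∧ ((One A m ∧ One A n) ∨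
    (side m = side n ∧ Col (kind (blk m) (side m)) (val m) (val n))))

variable {A : ℕ × ℕ → Prop}

theorem Rel.symm {m n : ℕ} (h : Rel A m n) : Rel A n m := by
  rcases h with ⟨h1, h2⟩ | ⟨h1, h2, ⟨h3, h4⟩ | ⟨h3, h4⟩⟩
  · exact Or.inl ⟨h2, h1⟩
  · exact Or.inr ⟨h1.symm, h2.symm, Or.inl ⟨h4, h3⟩⟩
  · refine Or.inr ⟨h1.symm, h2.symm, Or.inr ⟨h3.symm, ?_⟩⟩
    rw [← h1, ← h3]
    exact h4.symm

/-- The gluing at `1` does not disturb the zero class because `0` and `1` are inequivalent in every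
column; transitivity rests on this. -/
theorem Rel.zero {m n : ℕ} (h : Rel A m n) (hm : Zero m) : Zero n := by
  rcases h with ⟨h1, h2⟩ | ⟨h1, h2, ⟨h3, h4⟩ | ⟨h3, h4⟩⟩
  · exact h2
  · rcases hm with hm | hm
    · left; rwa [← h1, ← h2]
    · exact absurd (Col.trans hm.symm h3.2)
        (not_col_zero_one _)
  · rcases hm with hm | hm
    · left; rwa [← h1, ← h2]
    · right
      rw [← h1, ← h3]
      exact h4.symm.trans hm

theorem one_of_column {m n : ℕ} (hb : blk m = blk n) (hs : side m = side n)
    (h : Col (kind (blk m) (side m)) (val m) (val n)) (hm : One A m) : One A n := by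
  refine ⟨hb ▸ hm.1, ?_⟩
  rw [← hb, ← hs]
  exact h.symm.trans hm.2

variable (A) in
/-- All columns are joined at their class of `0`, and the two columns of the block of a pair
`p` with `A p` also at their class of `1`. -/
def rel : Setoid ℕ where
  r := Rel A
  iseqv := by
    refine ⟨fun n => Or.inr ⟨rfl, rfl, Or.inr ⟨rfl, Col.refl _ _⟩⟩, Rel.symm, ?_⟩
    intro l m n h h'
    rcases h with ⟨h1, h2⟩ | ⟨h1, h2, h3⟩
    · exact Or.inl ⟨h1, h'.zero h2⟩
    · rcases h' with ⟨h1', h2'⟩ | ⟨h1', h2', h3'⟩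
      · exact Or.inl ⟨Rel.zero (Rel.symm (A := A) (Or.inr ⟨h1, h2, h3⟩)) h1', h2'⟩
      · refine Or.inr ⟨h1.trans h1', h2.trans h2', ?_⟩
        rcases h3 with ⟨h4, h5⟩ | ⟨h4, h5⟩ <;> rcases h3' with ⟨h6, h7⟩ | ⟨h6, h7⟩
        · exact Or.inl ⟨h4, h7⟩
        · exact Or.inl ⟨h4, one_of_column h1' h6 h7 h5⟩
        · refine Or.inl ⟨one_of_column h1.symm h4.symm ?_ h6, h7⟩
          rw [← h1, ← h4]
          exact h5.symm
        · refine Or.inr ⟨h4.trans h6, h5.trans ?_⟩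
          rw [h1, h4]
          exact h7

theorem zero_re : REPred Zero := by
  refine (nonLive_re.comp (primrec_blk.pair primrec_stg).to_comp).or ?_
  exact col_re.comp ((primrec_kind.comp primrec_blk primrec_side).pair
    (primrec_val.pair (Primrec.const 0))).to_comp

theorem one_re (hA : REPred A) : REPred (One A) := by
  refine (hA.comp (Primrec.unpair.comp primrec_blk).to_comp).and ?_
  exact col_re.comp ((primrec_kind.comp primrec_blk primrec_side).pair
    (primrec_val.pair (Primrec.const 1))).to_comp

theorem rel_re (hA : REPred A) : REPred fun p : ℕ × ℕ => rel A p.1 p.2 := by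
  have h1 : Primrec fun p : ℕ × ℕ => p.1 := Primrec.fst
  have h2 : Primrec fun p : ℕ × ℕ => p.2 := Primrec.snd
  refine ((zero_re.comp h1.to_comp).and (zero_re.comp h2.to_comp)).or ?_
  refine (REPred.eq (primrec_blk.comp h1).to_comp (primrec_blk.comp h2).to_comp).and ?_
  refine (REPred.eq (primrec_stg.comp h1).to_comp (primrec_stg.comp h2).to_comp).and ?_
  refine (((one_re hA).comp h1.to_comp).and ((one_re hA).comp h2.to_comp)).or ?_
  refine REPred.and (REPred.of_primrec
    (Primrec.eq.comp (primrec_side.comp h1) (primrec_side.comp h2))) ?_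
  exact col_re.comp ((primrec_kind.comp (primrec_blk.comp h1)
    (primrec_side.comp h1)).pair ((primrec_val.comp h1).pair (primrec_val.comp h2))).to_comp

theorem rel_of_zero {m n : ℕ} (hm : Zero m) (hn : Zero n) : rel A m n := Or.inl ⟨hm, hn⟩

theorem zero_congr {m n : ℕ} (h : rel A m n) : Zero m ↔ Zero n :=
  ⟨Rel.zero h, Rel.zero (Rel.symm h)⟩

theorem zero_of_blk_ne {m n : ℕ} (h : rel A m n) (hne : blk m ≠ blk n) : Zero m := by
  rcases h with h | h
  · exact h.1
  · exact absurd h.1 hne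

/-- The embedding of a generic ceer as one of the two columns of block `k`. -/
noncomputable def emb (k : ℕ) (c : Bool) (x : ℕ) : ℕ :=
  Nat.pair k (Nat.pair (live k) (2 * x + c.toNat))

@[simp] theorem blk_emb (k : ℕ) (c : Bool) (x : ℕ) : blk (emb k c x) = k := by simp [blk, emb]
@[simp] theorem stg_emb (k : ℕ) (c : Bool) (x : ℕ) : stg (emb k c x) = live k := by simp [stg, emb]
@[simp] theorem side_emb (k : ℕ) (c : Bool) (x : ℕ) : side (emb k c x) = c := by
  cases c <;> simp [side, emb]
@[simp] theorem val_emb (k : ℕ) (c : Bool) (x : ℕ) : val (emb k c x) = x := by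
  cases c <;> simp [val, emb]
  omega

theorem computable_emb (k : ℕ) (c : Bool) : Computable (emb k c) :=
  (Primrec₂.natPair.comp (Primrec.const k) (Primrec₂.natPair.comp (Primrec.const (live k))
    (Primrec.nat_add.comp Primrec.nat_double (Primrec.const c.toNat)))).to_comp

@[simp] theorem zero_emb {k : ℕ} {c : Bool} {x : ℕ} :
    Zero (emb k c x) ↔ Col (kind k c) x 0 := by
  simp [Zero, not_nonLive_live]

theorem rel_emb {k : ℕ} {c : Bool} {x y : ℕ} :
    rel A (emb k c x) (emb k c y) ↔ Col (kind k c) x y := by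
  constructor
  · rintro (⟨h1, h2⟩ | ⟨-, -, ⟨h1, h2⟩ | ⟨-, h⟩⟩)
    · rw [zero_emb] at h1 h2
      exact h1.trans h2.symm
    · have h1 := h1.2
      have h2 := h2.2
      simp only [blk_emb, side_emb, val_emb] at h1 h2
      exact h1.trans h2.symm
    · simpa using h
  · intro h
    exact Or.inr ⟨by simp, by simp, Or.inr ⟨by simp, by simpa using h⟩⟩

theorem comap_emb (k : ℕ) (c : Bool) : (rel A).comap (emb k c) = column (kind k c) :=
  Setoid.ext fun _ _ => rel_emb.trans col_iff

theorem rel_emb_of_ne {k : ℕ} {c c' : Bool} (hc : c ≠ c') {x y : ℕ} :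
    rel A (emb k c x) (emb k c' y) ↔ (Col (kind k c) x 0 ∧ Col (kind k c') y 0) ∨
      (A k.unpair ∧ Col (kind k c) x 1 ∧ Col (kind k c') y 1) := by
  have : rel A (emb k c x) (emb k c' y) ↔ Rel A (emb k c x) (emb k c' y) := Iff.rfl
  rw [this, Rel]
  simp only [zero_emb, One, blk_emb, stg_emb, side_emb, val_emb, hc, false_and, or_false, true_and]
  tauto

/-- Only the live stage carries numbers outside the zero class, so such a number lies in an embedded
column. -/
theorem exists_emb {n : ℕ} (h : ¬ Zero n) : ∃ x, n = emb (blk n) (side n) x := by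
  refine ⟨val n, ?_⟩
  have h1 : stg n = live (blk n) :=
    live_unique (fun h' => h (Or.inl h')) (not_nonLive_live _)
  have h2 : 2 * val n + (side n).toNat = n.unpair.2.unpair.2 := by
    unfold val side
    rcases Nat.mod_two_eq_zero_or_one n.unpair.2.unpair.2 with h | h <;> simp [h] <;> omega
  rw [emb, h2, ← h1, blk, stg, Nat.pair_unpair, Nat.pair_unpair]

theorem zero_mem_column (k : ℕ) (c : Bool) : Zero (emb k c 0) := by simp [Col.refl]

/-- A c.e. set that avoids the common class meets only finitely many blocks. -/
theorem exists_blk_bound {W : Set ℕ} (hW : REPred fun n => n ∈ W) (h : ∀ n ∈ W, ¬ Zero n) :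
    ∃ N, ∀ n ∈ W, blk n < N := by
  have hp : REPred fun a : ℕ × ℕ => a.2 ∈ W ∧ blk a.2 = a.1 :=
    (hW.comp Computable.snd).and (REPred.eq (primrec_blk.to_comp.comp Computable.snd) Computable.fst)
  obtain ⟨f, hf, hfp, hfd⟩ := hp.exists_partial_choice
  obtain ⟨c, hc⟩ := Nat.Partrec.Code.exists_code.1 (Partrec.nat_iff.1 hf)
  -- The bound is the index of a program that finds an element `v` of `W` in a given block: this
  -- program is counted in every block from its own index on.
  refine ⟨Encodable.encode c, fun n hn => ?_⟩
  by_contra hk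
  push Not at hk
  obtain ⟨v, hv⟩ := Part.dom_iff_mem.1 (hfd (blk n) ⟨n, hn, rfl⟩)
  obtain ⟨hvW, hvb⟩ := hfp _ v hv
  obtain ⟨s, hs⟩ := Nat.Partrec.Code.evaln_complete.1 (show v ∈ c.eval (blk n) by rwa [hc])
  have hlive : ¬ NonLive (blk n) (stg v) := fun h' => h v hvW (Or.inl (by rwa [← (show blk v = blk n from hvb)] at h'))
  set u := max (max s (v + 1)) (stg v + 1) with hu
  have hsu : s ≤ u := (le_max_left _ _).trans (le_max_left _ _)
  have hvu : v + 1 ≤ u := (le_max_right _ _).trans (le_max_left _ _)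
  have h1 : halted (Encodable.encode c) (blk n) u = 1 := by
    refine halted_eq_one_iff.2 ⟨v, ?_, by omega⟩
    rw [Denumerable.ofNat_encode]
    exact Nat.Partrec.Code.evaln_mono hsu hs
  have hle : stg v ≤ v := (Nat.unpair_left_le _).trans (Nat.unpair_right_le _)
  -- At stage `stg v ≤ v` the program is not yet counted, since its output `v` is not below that
  -- stage. It is counted at `u`, so the count still grows after `stg v`, which is therefore not
  -- live.
  have h2 : ¬ halted (Encodable.encode c) (blk n) (stg v) = 1 := by
    intro h'
    obtain ⟨w, hw, hlt⟩ := halted_eq_one_iff.1 h'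
    rw [Denumerable.ofNat_encode] at hw
    have := Part.mem_unique (Nat.Partrec.Code.evaln_sound hw) (Nat.Partrec.Code.evaln_sound hs)
    omega
  refine hlive ⟨u, Or.inr ⟨by omega, (Finset.sum_lt_sum (fun e _ => halted_mono e _ ?_)
    ⟨Encodable.encode c, ?_, ?_⟩).ne'⟩⟩
  · omega
  · simpa using Nat.lt_succ_of_le hk
  · have := halted_le_one (Encodable.encode c) (blk n) (stg v)
    omega

end Amalgam

/-- Total computable functions on `ℕ`. -/
abbrev CFun : Type := {p : ℕ → ℕ // Computable p}

namespace CFun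

/-- Composition of computable functions. -/
def comp (p r : CFun) : CFun := ⟨fun x => p.1 (r.1 x), p.2.comp r.2⟩

/-- The function with `p` on the even and `q` on the odd numbers. -/
def mix (p q : CFun) : CFun :=
  ⟨fun n => if n % 2 = 0 then p.1 (n / 2) else q.1 (n / 2),
    Computable.ite_of_decide computable_even (p.2.comp computable_div_two)
      (q.2.comp computable_div_two)⟩

theorem comp_apply (p r : CFun) (x : ℕ) : (p.comp r).1 x = p.1 (r.1 x) := rfl

@[simp] theorem mix_even (p q : CFun) (x : ℕ) : (p.mix q).1 (2 * x) = p.1 x := by simp [mix]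

@[simp] theorem mix_odd (p q : CFun) (x : ℕ) : (p.mix q).1 (2 * x + 1) = q.1 x := by
  have : (2 * x + 1) / 2 = x := by omega
  simp [mix, this, Nat.add_mod]

theorem mix_of_even (p q : CFun) {n : ℕ} (h : n % 2 = 0) : (p.mix q).1 n = p.1 (n / 2) := by
  simp [mix, h]

theorem mix_of_odd (p q : CFun) {n : ℕ} (h : ¬ n % 2 = 0) : (p.mix q).1 n = q.1 (n / 2) := by
  simp [mix, h]

end CFun

/-! ### Degrees below a ceer as restrictions to c.e. parts -/

namespace Ceer

variable (S : Ceer)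

/-- The pullback of a ceer by a computable function. -/
def pull (p : CFun) : Ceer where
  rel := S.rel.comap p.1
  ce := S.ce.comp ((p.2.comp Computable.fst).pair (p.2.comp Computable.snd))

/-- The degree of the restriction of `S` to the range of `p`. -/
def sub (p : CFun) : IDegree := (S.pull p).iDeg

variable {S} {p q : CFun}

theorem iDeg_le_iff {R T : Ceer} : R.iDeg ≤ T.iDeg ↔ LeI R.rel T.rel := Iff.rfl

theorem iDeg_eq_of_rel_eq {R T : Ceer} (h : R.rel = T.rel) : R.iDeg = T.iDeg :=
  le_antisymm (iDeg_le_iff.2 (h ▸ LeI.refl _)) (iDeg_le_iff.2 (h ▸ LeI.refl _))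

theorem sub_le_iff : S.sub p ≤ S.sub q ↔ LeI (S.rel.comap p.1) (S.rel.comap q.1) := Iff.rfl

theorem sub_le_iDeg (p : CFun) : S.sub p ≤ S.iDeg := (compReducible_comap p.2).leI

theorem sub_le_of_subset (h : ∀ x, ∃ y, S.rel (p.1 x) (q.1 y)) : S.sub p ≤ S.sub q :=
  (CompReducible.of_subset S.ce p.2 q.2 h).leI

/-- Finitely many classes outside the range of `q` are absorbed by the finite summand. -/
theorem sub_le_of_finOver {W : Set ℕ} (hW : FinOver (S.rel.comap p.1) W)
    (h : ∀ x, x ∈ W ∨ ∃ y, S.rel (p.1 x) (q.1 y)) : S.sub p ≤ S.sub q := by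
  classical
  obtain ⟨F, hF⟩ := hW
  refine LeI.of_finset S.ce p.2 q.2 (F.image p.1) fun x => ?_
  rcases h x with hx | hx
  · obtain ⟨z, hz, hxz⟩ := hF x hx
    exact Or.inr ⟨_, Finset.mem_image_of_mem _ hz, hxz⟩
  · exact Or.inl hx

theorem sub_comp_le (p r : CFun) : S.sub (p.comp r) ≤ S.sub p :=
  sub_le_of_subset fun x => ⟨r.1 x, S.rel.refl _⟩

theorem iDeg_eq_bot_iff : S.iDeg = ⊥ ↔ FinOver S.rel Set.univ := by
  rw [← le_bot_iff]
  exact ⟨finOver_of_leI_idMod_one, FinOver.leI_idMod_one S.ce⟩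

theorem sub_eq_bot_iff : S.sub p = ⊥ ↔ FinOver (S.rel.comap p.1) Set.univ := iDeg_eq_bot_iff

theorem exists_eq_sub {d : IDegree} (h : d ≤ S.iDeg) : ∃ p, d = S.sub p := by
  induction d using Quotient.ind with
  | _ R =>
    obtain ⟨r, g, hr, hg, hrg, hR⟩ := LeI.exists_restrict (iDeg_le_iff.1 h)
    have e : R.rel.comap r = S.rel.comap g := Setoid.ext hrg
    refine ⟨⟨g, hg⟩, le_antisymm (iDeg_le_iff.2 ?_) (iDeg_le_iff.2 ?_)⟩
    · exact (show LeI R.rel (S.rel.comap g) from e ▸ hR)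
    · exact (show LeI (S.rel.comap g) R.rel from e ▸ (compReducible_comap hr).leI)

theorem exists_eq_sub_comp {d : IDegree} (h : d ≤ S.sub p) : ∃ r, d = S.sub (p.comp r) :=
  exists_eq_sub (S := S.pull p) h

theorem sub_le_mix_left (p q : CFun) : S.sub p ≤ S.sub (p.mix q) :=
  sub_le_of_subset fun x => ⟨2 * x, by rw [CFun.mix_even]⟩

theorem sub_le_mix_right (p q : CFun) : S.sub q ≤ S.sub (p.mix q) :=
  sub_le_of_subset fun x => ⟨2 * x + 1, by rw [CFun.mix_odd]⟩

theorem mix_subset {p q p' q' : CFun} (hp : ∀ x, ∃ y, S.rel (p.1 x) (p'.1 y))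
    (hq : ∀ x, ∃ y, S.rel (q.1 x) (q'.1 y)) (n : ℕ) :
    ∃ m, S.rel ((p.mix q).1 n) ((p'.mix q').1 m) := by
  by_cases hn : n % 2 = 0
  · obtain ⟨y, hy⟩ := hp (n / 2)
    exact ⟨2 * y, by rwa [CFun.mix_of_even _ _ hn, CFun.mix_even]⟩
  · obtain ⟨y, hy⟩ := hq (n / 2)
    exact ⟨2 * y + 1, by rwa [CFun.mix_of_odd _ _ hn, CFun.mix_odd]⟩

/-- The c.e. set of the indices `x` for which `p x` is equivalent to some `q y`. -/
theorem re_meets (S : Ceer) (p q : CFun) : REPred fun x => ∃ y, S.rel (p.1 x) (q.1 y) :=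
  REPred.exists_nat (p := fun a : ℕ × ℕ => S.rel (p.1 a.1) (q.1 a.2))
    (S.ce.comp ((p.2.comp Computable.fst).pair (q.2.comp Computable.snd)))

/-- Anything below is the restriction to the range of some `p`. By goodness this range meets
finitely many classes, giving `⊥`, or all classes, giving the whole degree. -/
theorem isAtom_of_good (h : Good S.rel) : IsAtom S.iDeg := by
  refine ⟨fun hb => h.1 (iDeg_eq_bot_iff.1 hb), fun x hx => ?_⟩
  obtain ⟨p, rfl⟩ := exists_eq_sub hx.le
  have hre : REPred fun n => n ∈ {n | ∃ x, n = p.1 x} :=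
    REPred.exists_nat (p := fun a : ℕ × ℕ => a.1 = p.1 a.2)
      (REPred.eq Computable.fst (p.2.comp Computable.snd))
  rcases h.2 {n | ∃ x, n = p.1 x} hre with hW | hW
  · exact sub_eq_bot_iff.2 (hW.of_map p.1 (fun x _ => ⟨x, rfl⟩) fun x _ y _ hxy => hxy)
  · refine absurd hx (not_lt_of_ge ?_)
    refine (CompReducible.of_subset S.ce Computable.id p.2 fun n => ?_).leI
    obtain ⟨_, ⟨x, rfl⟩, hx⟩ := hW n
    exact ⟨x, hx⟩

/-- A reduction of a good ceer into a good part of `S` is onto this part. -/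
theorem onto_of_good {R : Setoid ℕ} (hR : Good R) {f : CFun}
    (hf : ∀ x y, R x y ↔ S.rel (f.1 x) (f.1 y)) (hp : Good (S.rel.comap p.1))
    (h : ∀ x, ∃ y, S.rel (f.1 x) (p.1 y)) (y : ℕ) : ∃ x, S.rel (p.1 y) (f.1 x) := by
  rcases hp.2 {y | ∃ x, S.rel (p.1 y) (f.1 x)} (S.re_meets p f) with hW | hW
  · choose g hg using h
    refine absurd (hW.of_map g (W := Set.univ) (fun x _ => ⟨x, S.rel.symm (hg x)⟩)
      fun x _ y _ hxy => ?_) hR.1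
    exact (hf x y).2 (S.rel.trans (hg x) (S.rel.trans hxy (S.rel.symm (hg y))))
  · obtain ⟨z, ⟨x, hx⟩, hyz⟩ := hW y
    exact ⟨x, S.rel.trans hyz hx⟩

end Ceer

/-! ### The atoms given by the columns -/

namespace IDegree

theorem IsStronglyMinimalCover.eq_of_le {a d e x : IDegree} (h : IsStronglyMinimalCover a d e)
    (hx : x ≤ a) (hd : d ≤ x) (he : e ≤ x) : x = a := by
  by_contra hne
  rcases h.2.2 x (lt_of_le_of_ne hx hne) with h' | h'
  · exact h.1.2 (he.trans h')
  · exact h.1.1 (hd.trans h')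

/-- The degree of a column of the generic ceer. -/
def colDeg (i : ℕ) : IDegree := Ceer.iDeg
  ⟨GenericCeer.column i, GenericCeer.column_re.comp ((Computable.const i).pair Computable.id)⟩

theorem isAtom_colDeg (i : ℕ) : IsAtom (colDeg i) := Ceer.isAtom_of_good (GenericCeer.good_column i)

theorem colDeg_le_iff {i j : ℕ} : colDeg i ≤ colDeg j ↔ i = j := by
  refine ⟨fun h => ?_, fun h => h ▸ le_rfl⟩
  by_contra hne
  exact GenericCeer.not_compReducible_column hne
    ((GenericCeer.good_column i).compReducible (Ceer.iDeg_le_iff.1 h))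

theorem colDeg_injective : Function.Injective colDeg := fun _ _ h => colDeg_le_iff.1 h.le

end IDegree

/-! ### Atoms below the amalgam: columns and thin sets -/

namespace Amalgam

open GenericCeer (column good_column)
open IDegree

variable {A : ℕ × ℕ → Prop}

/-- The amalgam as a ceer. -/
def ceer (hA : REPred A) : Ceer := ⟨rel A, rel_re hA⟩

/-- The embedding of a column as a computable function. -/
noncomputable def cemb (k : ℕ) (c : Bool) : CFun := ⟨emb k c, computable_emb k c⟩

variable {hA : REPred A} {p q : CFun}

theorem good_comap_cemb (hA : REPred A) (k : ℕ) (c : Bool) :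
    Good ((ceer hA).rel.comap (cemb k c).1) := by
  have : (ceer hA).rel.comap (cemb k c).1 = column (kind k c) := comap_emb k c
  rw [this]
  exact good_column _

theorem sub_cemb (hA : REPred A) (k : ℕ) (c : Bool) :
    (ceer hA).sub (cemb k c) = colDeg (kind k c) :=
  Ceer.iDeg_eq_of_rel_eq (comap_emb k c)

theorem finOver_zero (hA : REPred A) (p : CFun) :
    FinOver ((ceer hA).rel.comap p.1) {x | Zero (p.1 x)} :=
  FinOver.of_key (fun _ => 0) 1 (fun _ _ => Nat.zero_lt_one) fun _ hx _ hy _ => rel_of_zero hx hy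

/-- The range of `p` meets only finitely many classes of each block. -/
def Thin (hA : REPred A) (p : CFun) : Prop :=
  ∀ k, FinOver ((ceer hA).rel.comap p.1) {x | blk (p.1 x) = k}

theorem Thin.comp (h : Thin hA p) (r : CFun) : Thin hA (p.comp r) := fun k =>
  (h k).of_map r.1 (fun _ hx => hx) fun _ _ _ _ hxy => hxy

theorem Thin.finOver_of_bounded (h : Thin hA p) {W : Set ℕ} {N : ℕ}
    (hW : ∀ x ∈ W, blk (p.1 x) < N) : FinOver ((ceer hA).rel.comap p.1) W :=
  FinOver.iUnion (n := N) (fun k _ => h k) fun x hx => ⟨_, hW x hx, rfl⟩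

theorem Thin.finOver_of_not_zero (h : Thin hA p) {T : Set ℕ} (hT : REPred fun x => x ∈ T)
    (hz : ∀ x ∈ T, ¬ Zero (p.1 x)) : FinOver ((ceer hA).rel.comap p.1) T := by
  have hre : REPred fun n => n ∈ {n | ∃ x, x ∈ T ∧ n = p.1 x} :=
    REPred.exists_nat (p := fun a : ℕ × ℕ => a.2 ∈ T ∧ a.1 = p.1 a.2)
      ((hT.comp Computable.snd).and (REPred.eq Computable.fst (p.2.comp Computable.snd)))
  obtain ⟨N, hN⟩ := exists_blk_bound hre (by rintro _ ⟨x, hx, rfl⟩; exact hz x hx)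
  exact h.finOver_of_bounded fun x hx => hN _ ⟨x, hx, rfl⟩

/-- By goodness a column that is not covered is met in finitely many classes, and a block consists
of two columns and the zero class. -/
theorem thin_of_forall_not
    (h : ∀ k c, ¬ ∀ y, ∃ x, (ceer hA).rel ((cemb k c).1 y) (p.1 x)) : Thin hA p := by
  intro k
  have hc : ∀ c, FinOver ((ceer hA).rel.comap p.1)
      {x | ∃ y, (ceer hA).rel (p.1 x) ((cemb k c).1 y)} := by
    intro c
    rcases (good_comap_cemb hA k c).2 {y | ∃ x, (ceer hA).rel ((cemb k c).1 y) (p.1 x)}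
      (Ceer.re_meets _ _ _) with hW | hW
    · have hex : ∀ x, ∃ y, (∃ y, (ceer hA).rel (p.1 x) ((cemb k c).1 y)) →
          (ceer hA).rel (p.1 x) ((cemb k c).1 y) := fun x => by
        by_cases hx : ∃ y, (ceer hA).rel (p.1 x) ((cemb k c).1 y)
        · obtain ⟨y, hy⟩ := hx
          exact ⟨y, fun _ => hy⟩
        · exact ⟨0, fun h' => absurd h' hx⟩
      choose g hg using hex
      refine hW.of_map g (fun x hx => ⟨x, (ceer hA).rel.symm (hg x hx)⟩) fun x hx y hy hxy => ?_
      exact (ceer hA).rel.trans (hg x hx) ((ceer hA).rel.trans hxy ((ceer hA).rel.symm (hg y hy)))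
    · refine absurd (fun y => ?_) (h k c)
      obtain ⟨z, ⟨x, hx⟩, hyz⟩ := hW y
      exact ⟨x, (ceer hA).rel.trans hyz hx⟩
  refine (((finOver_zero hA p).union (hc false)).union (hc true)).mono fun x hx => ?_
  by_cases hz : Zero (p.1 x)
  · exact Or.inl (Or.inl hz)
  · obtain ⟨y, hy⟩ := exists_emb hz
    have hxk : blk (p.1 x) = k := hx
    have : ∃ y, (ceer hA).rel (p.1 x) ((cemb k (side (p.1 x))).1 y) :=
      ⟨y, by
        have h2 : p.1 x = (cemb k (side (p.1 x))).1 y := by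
          refine hy.trans ?_
          rw [hxk]
          rfl
        rw [← h2]⟩
    cases hs : side (p.1 x) with
    | false => rw [hs] at this; exact Or.inl (Or.inr this)
    | true => rw [hs] at this; exact Or.inr this

/-- A good ceer below the amalgam is carried onto a column. -/
theorem exists_column_of_good {R : Setoid ℕ} (hR : Good R) {f : CFun}
    (hf : ∀ x y, R x y ↔ (ceer hA).rel (f.1 x) (f.1 y)) :
    ∃ k c, ∀ y, ∃ x, (ceer hA).rel ((cemb k c).1 y) (f.1 x) := by
  by_contra hcon
  push Not at hcon
  have hthin : Thin hA f := thin_of_forall_not fun k c h => by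
    obtain ⟨y, hy⟩ := hcon k c
    obtain ⟨x, hx⟩ := h y
    exact hy x hx
  have e : (ceer hA).rel.comap f.1 = R := Setoid.ext fun x y => (hf x y).symm
  obtain ⟨x, hx⟩ : ∃ x, ¬ Zero (f.1 x) := by
    by_contra hz
    push Not at hz
    exact hR.1 (e ▸ (finOver_zero hA f).mono fun x _ => hz x)
  -- Later blocks cannot contain the class of the nonzero number `f.1 x`, so by goodness they
  -- account for finitely many classes; thinness bounds the remaining blocks.
  have hre : REPred fun y => y ∈ {y | blk (f.1 x) < blk (f.1 y)} :=
    (REPred.of_primrec (p := fun n => blk (f.1 x) < blk n)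
      (Primrec.nat_lt.comp (Primrec.const _) primrec_blk)).comp f.2
  rcases hR.2 _ hre with hW | hW
  · have h1 : FinOver R {y | blk (f.1 y) < blk (f.1 x) + 1} :=
      e ▸ hthin.finOver_of_bounded fun y hy => hy
    exact hR.1 ((hW.union h1).mono fun y _ => by
      simp only [Set.mem_union, Set.mem_ofPred_eq]; omega)
  · obtain ⟨y, hy, hxy⟩ := hW x
    exact hx (zero_of_blk_ne ((hf x y).1 hxy) (Nat.ne_of_lt hy))

/-- `p` is a column, or thin. -/
def Nice (hA : REPred A) (p : CFun) : Prop := (∃ k c, p = cemb k c) ∨ Thin hA p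

/-- If the range covers a column, the degree of that column is nonzero and below the atom, hence
equal to it. Otherwise the range is thin. -/
theorem exists_nice (h : IsAtom ((ceer hA).sub p)) : ∃ p', (ceer hA).sub p' = (ceer hA).sub p ∧
    (∀ x, ∃ y, (ceer hA).rel (p'.1 x) (p.1 y)) ∧ Nice hA p' := by
  by_cases hc : ∃ k c, ∀ y, ∃ x, (ceer hA).rel ((cemb k c).1 y) (p.1 x)
  · obtain ⟨k, c, hc⟩ := hc
    refine ⟨cemb k c, ?_, hc, Or.inl ⟨k, c, rfl⟩⟩
    refine (h.le_iff.1 (Ceer.sub_le_of_subset hc)).resolve_left ?_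
    rw [sub_cemb]
    exact (isAtom_colDeg _).1
  · exact ⟨p, rfl, fun x => ⟨x, (ceer hA).rel.refl _⟩, Or.inr (thin_of_forall_not fun k c h =>
      hc ⟨k, c, h⟩)⟩

theorem Thin.exists_zero (h : Thin hA p) (hp : (ceer hA).sub p ≠ ⊥) : ∃ x, Zero (p.1 x) := by
  by_contra hz
  push Not at hz
  exact hp (Ceer.sub_eq_bot_iff.2 (h.finOver_of_not_zero (T := Set.univ) REPred.true fun x _ => hz x))

/-- The part shared with `q` has finitely many classes, represented in blocks up to some `B`.
Discarding these blocks from `p` costs finitely many classes by thinness, and a remaining common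
point is equivalent to a number in another block, hence zero. -/
theorem exists_separated (h : Thin hA p) (hp : (ceer hA).sub p ≠ ⊥)
    (hI : FinOver ((ceer hA).rel.comap p.1) {x | ∃ y, (ceer hA).rel (p.1 x) (q.1 y)}) :
    ∃ p', Thin hA p' ∧ (ceer hA).sub p' = (ceer hA).sub p ∧
      (∀ x, ∃ y, (ceer hA).rel (p'.1 x) (p.1 y)) ∧
      ∀ x y, (ceer hA).rel (p'.1 x) (q.1 y) → Zero (p'.1 x) := by
  obtain ⟨F, hF⟩ := hI
  set B := F.sup fun z => blk (p.1 z) with hB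
  obtain ⟨x₀, hx₀⟩ : ∃ x₀, B < blk (p.1 x₀) := by
    by_contra hcon
    push Not at hcon
    exact hp (Ceer.sub_eq_bot_iff.2 (h.finOver_of_bounded (N := B + 1) fun x _ =>
      Nat.lt_succ_of_le (hcon x)))
  have hr : Computable fun x => if B < blk (p.1 x) then x else x₀ := by
    refine Computable.ite_of_decide ?_ Computable.id (Computable.const x₀)
    exact (Primrec.nat_lt.comp (Primrec.const B) primrec_blk).decide.to_comp.comp p.2
  have hlt : ∀ x, B < blk ((p.comp ⟨_, hr⟩).1 x) := by
    intro x
    rw [CFun.comp_apply]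
    dsimp only
    split_ifs with hx <;> assumption
  refine ⟨p.comp ⟨_, hr⟩, h.comp _, le_antisymm (Ceer.sub_comp_le _ _) ?_,
    fun x => ⟨_, (ceer hA).rel.refl _⟩, fun x y hxy => ?_⟩
  · refine Ceer.sub_le_of_finOver (h.finOver_of_bounded (W := {x | ¬ B < blk (p.1 x)}) (N := B + 1)
      fun x hx => Nat.lt_succ_of_le (not_lt.1 hx)) fun x => ?_
    by_cases hx : B < blk (p.1 x)
    · refine Or.inr ⟨x, ?_⟩
      rw [CFun.comp_apply]
      simp [hx]
    · exact Or.inl hx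
  · obtain ⟨z, hz, hxz⟩ := hF _ ⟨y, hxy⟩
    have h1 : blk (p.1 z) ≤ B := Finset.le_sup (f := fun z => blk (p.1 z)) hz
    exact zero_of_blk_ne hxz (h1.trans_lt (hlt x)).ne'

/-- The common part is c.e. and its degree is below both; as `p` gives an atom not below `q`, that
degree is `⊥`. -/
theorem finOver_inter (hp : IsAtom ((ceer hA).sub p))
    (hne : ¬ (ceer hA).sub p ≤ (ceer hA).sub q) :
    FinOver ((ceer hA).rel.comap p.1) {x | ∃ y, (ceer hA).rel (p.1 x) (q.1 y)} := by
  by_cases hI : ∃ x, ∃ y, (ceer hA).rel (p.1 x) (q.1 y)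
  · obtain ⟨r, hr, hrI, hrs⟩ := (Ceer.re_meets (ceer hA) p q).exists_range hI
    have h1 : (ceer hA).sub (p.comp ⟨r, hr⟩) ≤ (ceer hA).sub p := Ceer.sub_comp_le _ _
    have h2 : (ceer hA).sub (p.comp ⟨r, hr⟩) ≤ (ceer hA).sub q := Ceer.sub_le_of_subset hrI
    have h3 : (ceer hA).sub (p.comp ⟨r, hr⟩) = ⊥ :=
      (hp.le_iff.1 h1).resolve_right fun h => hne (h ▸ h2)
    choose! g hg using hrs
    refine (Ceer.sub_eq_bot_iff.1 h3).of_map g (fun _ _ => trivial) fun x hx y hy hxy => ?_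
    have : (ceer hA).rel (p.1 (r (g x))) (p.1 (r (g y))) := hxy
    rwa [hg x hx, hg y hy] at this
  · exact ⟨∅, fun x hx => absurd ⟨x, hx⟩ hI⟩

/-- `a` is the degree of the union of copies `p` of `d` and `q` of `e`. -/
structure Splits (hA : REPred A) (a d e : IDegree) (p q : CFun) : Prop where
  left : (ceer hA).sub p = d
  right : (ceer hA).sub q = e
  total : (ceer hA).sub (p.mix q) = a

variable {a d e : IDegree}

/-- Copies of `d` and `e` inside a copy of `a` have a union that lies below `a` and above both, so
strong minimality makes it all of `a`. -/
theorem exists_splits (h : IsStronglyMinimalCover a d e) (ha : a ≤ (ceer hA).iDeg) :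
    ∃ p q, Splits hA a d e p q := by
  obtain ⟨g, rfl⟩ := Ceer.exists_eq_sub ha
  obtain ⟨r, rfl⟩ := Ceer.exists_eq_sub_comp h.2.1.1.le
  obtain ⟨s, rfl⟩ := Ceer.exists_eq_sub_comp h.2.1.2.le
  refine ⟨_, _, rfl, rfl, h.eq_of_le (Ceer.sub_le_of_subset fun n => ?_)
    (Ceer.sub_le_mix_left _ _) (Ceer.sub_le_mix_right _ _)⟩
  by_cases hn : n % 2 = 0
  · exact ⟨_, by rw [CFun.mix_of_even _ _ hn, CFun.comp_apply]⟩
  · exact ⟨_, by rw [CFun.mix_of_odd _ _ hn, CFun.comp_apply]⟩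

theorem Splits.restrict (h : IsStronglyMinimalCover a d e) (hs : Splits hA a d e p q) {p' q' : CFun}
    (hp : (ceer hA).sub p' = (ceer hA).sub p) (hq : (ceer hA).sub q' = (ceer hA).sub q)
    (hpp : ∀ x, ∃ y, (ceer hA).rel (p'.1 x) (p.1 y))
    (hqq : ∀ x, ∃ y, (ceer hA).rel (q'.1 x) (q.1 y)) : Splits hA a d e p' q' := by
  refine ⟨hp.trans hs.left, hq.trans hs.right, h.eq_of_le ?_ ?_ ?_⟩
  · rw [← hs.total]
    exact Ceer.sub_le_of_subset (Ceer.mix_subset hpp hqq)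
  · rw [← hs.left, ← hp]
    exact Ceer.sub_le_mix_left _ _
  · rw [← hs.right, ← hq]
    exact Ceer.sub_le_mix_right _ _

/-- The ranges of `p` and `q` have at most the common class in common. -/
def Sep (hA : REPred A) (p q : CFun) : Prop :=
  ∀ x y, (ceer hA).rel (p.1 x) (q.1 y) → Zero (p.1 x)

theorem Sep.symm (h : Sep hA p q) : Sep hA q p := fun x y hxy =>
  (zero_congr hxy).2 (h y x ((ceer hA).rel.symm hxy))

/-- Two columns sharing a nonzero class must be the two sides of an edge block. If one part is thin,
separation from the other part is always possible. -/
theorem exists_nice_splits (h : IsStronglyMinimalCover a d e) (ha : a ≤ (ceer hA).iDeg)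
    (hd : IsAtom d) (he : IsAtom e) :
    (∃ i j, d = colDeg i ∧ e = colDeg j ∧ (A (i, j) ∨ A (j, i))) ∨
      ∃ p q, Splits hA a d e p q ∧ Nice hA p ∧ Nice hA q ∧ Sep hA p q := by
  obtain ⟨p₀, q₀, hs₀⟩ := exists_splits h ha
  obtain ⟨p, hp, hpp, hpn⟩ := exists_nice (p := p₀) (hs₀.left ▸ hd)
  obtain ⟨q, hq, hqq, hqn⟩ := exists_nice (p := q₀) (hs₀.right ▸ he)
  have hs := hs₀.restrict h hp hq hpp hqq
  have hrefl : ∀ p : CFun, ∀ x, ∃ y, (ceer hA).rel (p.1 x) (p.1 y) :=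
    fun p x => ⟨x, (ceer hA).rel.refl _⟩
  have hda : IsAtom ((ceer hA).sub p) := hs.left ▸ hd
  have hea : IsAtom ((ceer hA).sub q) := hs.right ▸ he
  rcases hpn with ⟨k, c, rfl⟩ | hpt
  · rcases hqn with ⟨k', c', rfl⟩ | hqt
    · have hdk := hs.left
      have hek := hs.right
      rw [sub_cemb] at hdk hek
      have hne : kind k c ≠ kind k' c' := fun hk => h.1.1 (by rw [← hdk, ← hek, hk])
      by_cases hadj : k = k' ∧ A k.unpair
      · obtain ⟨rfl, hadj⟩ := hadj
        left
        refine ⟨_, _, hdk.symm, hek.symm, ?_⟩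
        cases c <;> cases c'
        · exact absurd rfl hne
        · exact Or.inl hadj
        · exact Or.inr hadj
        · exact absurd rfl hne
      · right
        refine ⟨_, _, hs, Or.inl ⟨k, c, rfl⟩, Or.inl ⟨k', c', rfl⟩, fun x y hxy => ?_⟩
        by_cases hk : k = k'
        · subst hk
          have hc : c ≠ c' := fun hc => hne (by rw [hc])
          rcases (rel_emb_of_ne hc).1 hxy with h' | h'
          · exact zero_emb.2 h'.1
          · exact absurd ⟨rfl, h'.1⟩ hadj
        · exact zero_of_blk_ne hxy (by simpa [cemb] using hk)
    · right
      obtain ⟨q', hq't, hq', hqq', hsep⟩ := exists_separated (q := cemb k c) hqt hea.1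
        (finOver_inter hea (by rw [hs.left, hs.right]; exact h.1.2))
      exact ⟨_, q', hs.restrict h rfl hq' (hrefl _) hqq', Or.inl ⟨k, c, rfl⟩, Or.inr hq't,
        Sep.symm hsep⟩
  · right
    obtain ⟨p', hp't, hp', hpp', hsep⟩ := exists_separated (q := q) hpt hda.1
      (finOver_inter hda (by rw [hs.left, hs.right]; exact h.1.1))
    exact ⟨p', q, hs.restrict h hp' rfl hpp' (hrefl _), Or.inr hp't, hqn, hsep⟩

/-- A thin set has a degree other than that of a column. -/
theorem Thin.sub_ne_colDeg (h : Thin hA p) (i : ℕ) : (ceer hA).sub p ≠ colDeg i := by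
  intro heq
  obtain ⟨f, hf, hred⟩ := (good_column i).compReducible (Ceer.iDeg_le_iff.1 heq.ge)
  -- A good ceer inside a thin set would cover a whole column, which has infinitely many classes in
  -- one block.
  obtain ⟨k, c, hkc⟩ := exists_column_of_good (hA := hA) (good_column i) (f := p.comp ⟨f, hf⟩) hred
  choose g hg using hkc
  refine (good_comap_cemb hA k c).1 (((h.comp ⟨f, hf⟩) k |>.union
    (finOver_zero hA (p.comp ⟨f, hf⟩))).of_map g (fun y _ => ?_) fun x _ y _ hxy => ?_)
  · by_cases hb : blk ((p.comp ⟨f, hf⟩).1 (g y)) = k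
    · exact Or.inl hb
    · refine Or.inr ((zero_congr (hg y)).1 (zero_of_blk_ne (hg y) ?_))
      simpa [cemb] using fun h' => hb h'.symm
  · exact (ceer hA).rel.trans (hg x) ((ceer hA).rel.trans hxy ((ceer hA).rel.symm (hg y)))

/-- Reductions between nice copies of an atom can be chosen to preserve the common class. -/
theorem exists_zero_preserving (hp : Nice hA p) (hq : Nice hA q)
    (hpq : (ceer hA).sub p = (ceer hA).sub q) (hatom : IsAtom ((ceer hA).sub p)) :
    ∃ (p' f : CFun), (ceer hA).sub p' = (ceer hA).sub p ∧
      (∀ x, ∃ y, (ceer hA).rel (p'.1 x) (p.1 y)) ∧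
      (∀ x y, (ceer hA).rel (p'.1 x) (p'.1 y) ↔ (ceer hA).rel (q.1 (f.1 x)) (q.1 (f.1 y))) ∧
      ∀ x, Zero (p'.1 x) ↔ Zero (q.1 (f.1 x)) := by
  rcases hp with ⟨k, c, rfl⟩ | hpt
  · rcases hq with ⟨k', c', rfl⟩ | hqt
    · rw [sub_cemb, sub_cemb] at hpq
      have hk := colDeg_injective hpq
      refine ⟨cemb k c, ⟨id, Computable.id⟩, rfl, fun x => ⟨x, (ceer hA).rel.refl _⟩,
        fun x y => ?_, fun x => ?_⟩
      · exact rel_emb.trans (hk ▸ rel_emb.symm)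
      · exact zero_emb.trans (hk ▸ zero_emb.symm)
    · rw [sub_cemb] at hpq
      exact absurd hpq.symm (hqt.sub_ne_colDeg _)
  · rcases hq with ⟨k', c', rfl⟩ | hqt
    · rw [sub_cemb] at hpq
      exact absurd hpq (hpt.sub_ne_colDeg _)
    · obtain ⟨r, g, hr, hg, hrg, hle⟩ := LeI.exists_restrict (Ceer.sub_le_iff.1 hpq.le)
      set p' := p.comp ⟨r, hr⟩
      have hrg' : ∀ x y, (ceer hA).rel (p'.1 x) (p'.1 y) ↔
        (ceer hA).rel (q.1 (g x)) (q.1 (g y)) := hrg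
      have hp' : (ceer hA).sub p' = (ceer hA).sub p :=
        le_antisymm (Ceer.sub_comp_le _ _) hle
      have hne : (ceer hA).sub p' ≠ ⊥ := hp' ▸ hatom.1
      have hp't : Thin hA p' := hpt.comp _
      -- Suppose the zero class goes to a nonzero class in a block. Points with images in other
      -- blocks form a c.e. set avoiding zero, hence cover finitely many classes as `p'` is thin;
      -- points with images in that block do so as `q` is thin. Then `p'` would give `⊥`.
      have key : ∀ x, Zero (p'.1 x) → Zero (q.1 (g x)) := by
        intro x hx
        by_contra hz
        have hre : REPred fun y => y ∈ {y | blk (q.1 (g y)) ≠ blk (q.1 (g x))} :=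
          REPred.ne (primrec_blk.to_comp.comp (q.2.comp hg)) (Computable.const _)
        have h1 : FinOver ((ceer hA).rel.comap p'.1) {y | blk (q.1 (g y)) ≠ blk (q.1 (g x))} :=
          hp't.finOver_of_not_zero hre fun y hy hzy =>
            hz (zero_of_blk_ne ((hrg' x y).1 (rel_of_zero hx hzy)) (Ne.symm hy))
        have h2 : FinOver ((ceer hA).rel.comap p'.1) {y | blk (q.1 (g y)) = blk (q.1 (g x))} :=
          (hqt (blk (q.1 (g x)))).of_map g (fun y hy => hy) fun y _ z _ hyz => (hrg' y z).2 hyz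
        exact hne (Ceer.sub_eq_bot_iff.2 ((h1.union h2).mono fun y _ => (em _).symm))
      refine ⟨p', ⟨g, hg⟩, hp', fun x => ⟨r x, (ceer hA).rel.refl _⟩, hrg', fun x => ⟨key x, ?_⟩⟩
      intro hz
      -- A thin part of nonzero degree meets the zero class; its image there is zero, so injectivity
      -- on classes gives the converse.
      obtain ⟨y, hy⟩ := hp't.exists_zero hne
      exact (zero_congr ((hrg' x y).2 (rel_of_zero hz (key y hy)))).2 hy

end Amalgam

/-! ### Reductions defined on unions of good parts -/

namespace Ceer

variable {S : Ceer} {p q : CFun}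

theorem exists_reduction_of_mix {T : Setoid ℕ} (hp : Good (S.rel.comap p.1))
    (hq : Good (S.rel.comap q.1)) (h : LeI (S.rel.comap (p.mix q).1) T) :
    ∃ f : CFun, ∀ m n, S.rel ((p.mix q).1 m) ((p.mix q).1 n) ↔ T (f.1 m) (f.1 n) := by
  obtain ⟨k, f, hf, h⟩ := h.exists_map
  have h0 := hp.map_even (S := T) (k := k) (f := fun x => f (2 * x))
    (hf.comp Primrec.nat_double.to_comp) fun x y => by
      rw [← h]; simp only [Setoid.comap_rel, CFun.mix_even]
  have h1 := hq.map_even (S := T) (k := k) (f := fun x => f (2 * x + 1))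
    (hf.comp Primrec.nat_double_succ.to_comp) fun x y => by
      rw [← h]; simp only [Setoid.comap_rel, CFun.mix_odd]
  have heven : ∀ n, f n % 2 = 0 := by
    intro n
    rcases Nat.even_or_odd' n with ⟨m, rfl | rfl⟩
    exacts [h0 m, h1 m]
  exact ⟨⟨fun x => f x / 2, computable_div_two.comp hf⟩, fun m n => (h m n).trans (by simp [heven])⟩

/-- One of the preimages of the ranges of `p` and `q` meets every class. It cannot be only the one
of `q`, since that would reduce `R` to the `q` part. -/
theorem subset_of_good {R : Setoid ℕ} (hR : Good R) {f : CFun}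
    (hf : ∀ x y, R x y ↔ S.rel (f.1 x) (f.1 y)) (hq : ¬ CompReducible R (S.rel.comap q.1))
    (h : ∀ x, (∃ y, S.rel (f.1 x) (p.1 y)) ∨ ∃ y, S.rel (f.1 x) (q.1 y)) (x : ℕ) :
    ∃ y, S.rel (f.1 x) (p.1 y) := by
  rcases hR.2 {x | ∃ y, S.rel (f.1 x) (p.1 y)} (S.re_meets f p) with h1 | h1
  · rcases hR.2 {x | ∃ y, S.rel (f.1 x) (q.1 y)} (S.re_meets f q) with h2 | h2
    · exact absurd ((h1.union h2).mono fun x _ => h x) hR.1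
    · refine absurd ?_ hq
      have e : S.rel.comap f.1 = R := Setoid.ext fun x y => (hf x y).symm
      rw [← e]
      refine CompReducible.of_subset S.ce f.2 q.2 fun x => ?_
      obtain ⟨z, ⟨y, hy⟩, hxz⟩ := h2 x
      exact ⟨y, S.rel.trans ((hf x z).1 hxz) hy⟩
  · obtain ⟨z, ⟨y, hy⟩, hxz⟩ := h1 x
    exact ⟨y, S.rel.trans ((hf x z).1 hxz) hy⟩

theorem mix_cases (S : Ceer) (p q : CFun) (n : ℕ) :
    (∃ y, S.rel ((p.mix q).1 n) (p.1 y)) ∨ ∃ y, S.rel ((p.mix q).1 n) (q.1 y) := by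
  by_cases hn : n % 2 = 0
  · exact Or.inl ⟨n / 2, by rw [CFun.mix_of_even _ _ hn]⟩
  · exact Or.inr ⟨n / 2, by rw [CFun.mix_of_odd _ _ hn]⟩

end Ceer

/-! ### Covers of pairs of atoms, adjacency and darkness -/

namespace Amalgam

open GenericCeer (column good_column)
open IDegree

variable {A : ℕ × ℕ → Prop} {hA : REPred A} {p q p' q' : CFun}

/-- Cross relations between separated parts occur only through the zero class, so reductions of the
parts that respect it combine. -/
theorem sub_mix_le (hs : Sep hA p q) (hs' : Sep hA p' q') {f g : CFun}
    (hf : ∀ x y, (ceer hA).rel (p.1 x) (p.1 y) ↔ (ceer hA).rel (p'.1 (f.1 x)) (p'.1 (f.1 y)))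
    (hg : ∀ x y, (ceer hA).rel (q.1 x) (q.1 y) ↔ (ceer hA).rel (q'.1 (g.1 x)) (q'.1 (g.1 y)))
    (hf0 : ∀ x, Zero (p.1 x) ↔ Zero (p'.1 (f.1 x)))
    (hg0 : ∀ x, Zero (q.1 x) ↔ Zero (q'.1 (g.1 x))) :
    (ceer hA).sub (p.mix q) ≤ (ceer hA).sub (p'.mix q') := by
  have hfg : ∀ x y, (ceer hA).rel (p.1 x) (q.1 y) ↔
      (ceer hA).rel (p'.1 (f.1 x)) (q'.1 (g.1 y)) := by
    intro x y
    constructor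
    · intro h
      have hz := hs x y h
      exact rel_of_zero ((hf0 x).1 hz) ((hg0 y).1 ((zero_congr h).1 hz))
    · intro h
      have hz := hs' _ _ h
      exact rel_of_zero ((hf0 x).2 hz) ((hg0 y).2 ((zero_congr h).1 hz))
  refine CompReducible.leI ⟨fun n => if n % 2 = 0 then 2 * f.1 (n / 2) else 2 * g.1 (n / 2) + 1,
    Computable.ite_of_decide computable_even
      (Primrec.nat_double.to_comp.comp (f.2.comp computable_div_two))
      (Primrec.nat_double_succ.to_comp.comp (g.2.comp computable_div_two)), fun m n => ?_⟩
  change (ceer hA).rel ((p.mix q).1 m) ((p.mix q).1 n) ↔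
    (ceer hA).rel ((p'.mix q').1 _) ((p'.mix q').1 _)
  by_cases hm : m % 2 = 0 <;> by_cases hn : n % 2 = 0 <;>
    simp only [hm, hn, if_true, if_false, CFun.mix_even, CFun.mix_odd, CFun.mix_of_even,
      CFun.mix_of_odd, not_false_eq_true]
  · exact hf _ _
  · exact hfg _ _
  · exact ((ceer hA).rel.comm).trans ((hfg _ _).trans ((ceer hA).rel.comm))
  · exact hg _ _

variable {a b d e : IDegree}

/-- Without an edge both covers are unions of nice copies of `d` and `e` sharing at most the zero
class; combining zero-preserving reductions gives `a ≤ b`. -/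
theorem exists_adj_of_covers (ha : IsStronglyMinimalCover a d e)
    (hb : IsStronglyMinimalCover b d e) (hac : a ≤ (ceer hA).iDeg) (hbc : b ≤ (ceer hA).iDeg)
    (hd : IsAtom d) (he : IsAtom e) (hab : ¬ a ≤ b) :
    ∃ i j, d = colDeg i ∧ e = colDeg j ∧ (A (i, j) ∨ A (j, i)) := by
  rcases exists_nice_splits ha hac hd he with h | ⟨p, q, hpq, hp, hq, hsep⟩
  · exact h
  rcases exists_nice_splits hb hbc hd he with h | ⟨p', q', hpq', hp', hq', hsep'⟩
  · exact h
  refine absurd ?_ hab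
  obtain ⟨p₁, f, hp₁, hpp, hf, hf0⟩ := exists_zero_preserving hp hp'
    (hpq.left.trans hpq'.left.symm) (hpq.left ▸ hd)
  obtain ⟨q₁, g, hq₁, hqq, hg, hg0⟩ := exists_zero_preserving hq hq'
    (hpq.right.trans hpq'.right.symm) (hpq.right ▸ he)
  rw [← (hpq.restrict ha hp₁ hq₁ hpp hqq).total, ← hpq'.total]
  refine sub_mix_le (fun x y hxy => ?_) hsep' hf hg hf0 hg0
  obtain ⟨x', hx'⟩ := hpp x
  obtain ⟨y', hy'⟩ := hqq y
  exact (zero_congr hx').2 (hsep x' y' ((ceer hA).rel.trans ((ceer hA).rel.symm hx')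
    ((ceer hA).rel.trans hxy hy')))

theorem cover_of_columns {k k' : ℕ} {c c' : Bool} (h : kind k c ≠ kind k' c') :
    IsStronglyMinimalCover ((ceer hA).sub ((cemb k c).mix (cemb k' c')))
      (colDeg (kind k c)) (colDeg (kind k' c')) := by
  have h1 : colDeg (kind k c) ≤ (ceer hA).sub ((cemb k c).mix (cemb k' c')) :=
    sub_cemb hA k c ▸ Ceer.sub_le_mix_left _ _
  have h2 : colDeg (kind k' c') ≤ (ceer hA).sub ((cemb k c).mix (cemb k' c')) :=
    sub_cemb hA k' c' ▸ Ceer.sub_le_mix_right _ _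
  refine ⟨⟨fun h' => h (colDeg_le_iff.1 h'), fun h' => h (colDeg_le_iff.1 h').symm⟩,
    ⟨lt_of_le_not_ge h1 fun h' => h (colDeg_le_iff.1 (h2.trans h')).symm,
      lt_of_le_not_ge h2 fun h' => h (colDeg_le_iff.1 (h1.trans h'))⟩, fun x hx => ?_⟩
  obtain ⟨r, rfl⟩ := Ceer.exists_eq_sub_comp hx.le
  set m := (cemb k c).mix (cemb k' c') with hm
  -- By goodness a c.e. part of the union covers the column `t`, or meets it in finitely many
  -- classes and so lies below the other column `s`.
  have key : ∀ k₁ c₁ (t : CFun), t = cemb k₁ c₁ → ∀ s : CFun,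
      (∀ n, (∃ y, (ceer hA).rel (m.1 n) (t.1 y)) ∨ ∃ y, (ceer hA).rel (m.1 n) (s.1 y)) →
      (∀ y, ∃ x, (ceer hA).rel (t.1 y) ((m.comp r).1 x)) ∨
        (ceer hA).sub (m.comp r) ≤ (ceer hA).sub s := by
    rintro k₁ c₁ t rfl s hts
    rcases (good_comap_cemb hA k₁ c₁).2 {y | ∃ x, (ceer hA).rel ((cemb k₁ c₁).1 y) ((m.comp r).1 x)}
      (Ceer.re_meets _ _ _) with hW | hW
    · right
      have hex : ∀ x, ∃ y, (∃ y, (ceer hA).rel ((m.comp r).1 x) ((cemb k₁ c₁).1 y)) →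
          (ceer hA).rel ((m.comp r).1 x) ((cemb k₁ c₁).1 y) := fun x => by
        by_cases hx : ∃ y, (ceer hA).rel ((m.comp r).1 x) ((cemb k₁ c₁).1 y)
        · obtain ⟨y, hy⟩ := hx
          exact ⟨y, fun _ => hy⟩
        · exact ⟨0, fun h' => absurd h' hx⟩
      choose g hg using hex
      refine Ceer.sub_le_of_finOver
        (W := {x | ∃ y, (ceer hA).rel ((m.comp r).1 x) ((cemb k₁ c₁).1 y)})
        (hW.of_map g (fun x hx => ⟨x, (ceer hA).rel.symm (hg x hx)⟩) fun x hx y hy hxy => ?_)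
        fun x => hts (r.1 x)
      exact (ceer hA).rel.trans (hg x hx) ((ceer hA).rel.trans hxy ((ceer hA).rel.symm (hg y hy)))
    · left
      intro y
      obtain ⟨z, ⟨x, hx⟩, hyz⟩ := hW y
      exact ⟨x, (ceer hA).rel.trans hyz hx⟩
  rcases key k c _ rfl (cemb k' c') (Ceer.mix_cases _ _ _) with hl | hl
  · rcases key k' c' _ rfl (cemb k c) (fun n => (Ceer.mix_cases _ _ _ n).symm) with hr | hr
    · refine absurd hx (not_lt_of_ge (Ceer.sub_le_of_subset fun n => ?_))
      rcases Ceer.mix_cases (ceer hA) (cemb k c) (cemb k' c') n with ⟨y, hy⟩ | ⟨y, hy⟩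
      · obtain ⟨x, hx⟩ := hl y
        exact ⟨x, (ceer hA).rel.trans hy hx⟩
      · obtain ⟨x, hx⟩ := hr y
        exact ⟨x, (ceer hA).rel.trans hy hx⟩
    · exact Or.inl (sub_cemb hA k c ▸ hr)
  · exact Or.inr (sub_cemb hA k' c' ▸ hl)

/-- A reduction between two pairs of columns of the same kinds carries each column onto the
column of the same kind. -/
theorem exists_column_reduction {k k' l l' : ℕ} {c c' b b' : Bool} (h : kind k c ≠ kind k' c')
    (hl : kind l b = kind k c) (hl' : kind l' b' = kind k' c')
    (hle : (ceer hA).sub ((cemb k c).mix (cemb k' c')) ≤ (ceer hA).sub ((cemb l b).mix (cemb l' b'))) :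
    ∃ f g : ℕ → ℕ,
      (∀ x y, (ceer hA).rel ((cemb k c).1 x) ((cemb k c).1 y) ↔ (ceer hA).rel (f x) (f y)) ∧
      (∀ x y, (ceer hA).rel ((cemb k c).1 x) ((cemb k' c').1 y) ↔ (ceer hA).rel (f x) (g y)) ∧
      (∀ x, ∃ y, (ceer hA).rel (f x) ((cemb l b).1 y)) ∧
      (∀ x, ∃ y, (ceer hA).rel (g x) ((cemb l' b').1 y)) ∧
      (∀ y, ∃ x, (ceer hA).rel ((cemb l b).1 y) (f x)) ∧
      ∀ y, ∃ x, (ceer hA).rel ((cemb l' b').1 y) (g x) := by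
  obtain ⟨F, hF⟩ := Ceer.exists_reduction_of_mix (good_comap_cemb hA k c)
    (good_comap_cemb hA k' c') (Ceer.sub_le_iff.1 hle)
  set m := (cemb l b).mix (cemb l' b') with hm
  let f : CFun := ⟨fun x => m.1 (F.1 (2 * x)), m.2.comp (F.2.comp Primrec.nat_double.to_comp)⟩
  let g : CFun := ⟨fun x => m.1 (F.1 (2 * x + 1)),
    m.2.comp (F.2.comp Primrec.nat_double_succ.to_comp)⟩
  have hff : ∀ x y, (ceer hA).rel ((cemb k c).1 x) ((cemb k c).1 y) ↔
      (ceer hA).rel (f.1 x) (f.1 y) := fun x y => by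
    have := hF (2 * x) (2 * y)
    rwa [CFun.mix_even, CFun.mix_even] at this
  have hgg : ∀ x y, (ceer hA).rel ((cemb k' c').1 x) ((cemb k' c').1 y) ↔
      (ceer hA).rel (g.1 x) (g.1 y) := fun x y => by
    have := hF (2 * x + 1) (2 * y + 1)
    rwa [CFun.mix_odd, CFun.mix_odd] at this
  have hfg : ∀ x y, (ceer hA).rel ((cemb k c).1 x) ((cemb k' c').1 y) ↔
      (ceer hA).rel (f.1 x) (g.1 y) := fun x y => by
    have := hF (2 * x) (2 * y + 1)
    rwa [CFun.mix_even, CFun.mix_odd] at this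
  have hnot : ∀ k c l b, kind k c ≠ kind l b →
      ¬ CompReducible ((ceer hA).rel.comap (cemb k c).1) ((ceer hA).rel.comap (cemb l b).1) := by
    intro k c l b hne hred
    refine hne (colDeg_le_iff.1 ?_)
    rw [← sub_cemb hA, ← sub_cemb hA]
    exact hred.leI
  have h1 := Ceer.subset_of_good (p := cemb l b) (q := cemb l' b') (good_comap_cemb hA k c)
    hff (hnot _ _ _ _ (hl' ▸ h)) fun x => Ceer.mix_cases _ _ _ _
  have h2 := Ceer.subset_of_good (p := cemb l' b') (q := cemb l b) (good_comap_cemb hA k' c')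
    hgg (hnot _ _ _ _ (hl ▸ h.symm)) fun x => (Ceer.mix_cases _ _ _ _).symm
  exact ⟨f.1, g.1, hff, hfg, h1, h2,
    Ceer.onto_of_good (good_comap_cemb hA k c) hff (good_comap_cemb hA l b) h1,
    Ceer.onto_of_good (good_comap_cemb hA k' c') hgg (good_comap_cemb hA l' b') h2⟩

theorem not_rel_zero_one (k : ℕ) (c : Bool) :
    ¬ (ceer hA).rel ((cemb k c).1 0) ((cemb k c).1 1) := fun h =>
  not_col_zero_one _ (rel_emb.1 h)

/-- Pairs of columns with one and with two common classes have incomparable degrees. -/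
theorem incomparable_of_adj {i j : ℕ} (hij : i ≠ j) (h : A (i, j)) :
    ¬ (ceer hA).sub ((cemb (Nat.pair i i) false).mix (cemb (Nat.pair j j) false)) ≤
        (ceer hA).sub ((cemb (Nat.pair i j) false).mix (cemb (Nat.pair i j) true)) ∧
    ¬ (ceer hA).sub ((cemb (Nat.pair i j) false).mix (cemb (Nat.pair i j) true)) ≤
        (ceer hA).sub ((cemb (Nat.pair i i) false).mix (cemb (Nat.pair j j) false)) := by
  have hsep : ∀ {n x y}, (ceer hA).rel n ((cemb (Nat.pair i i) false).1 x) →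
      (ceer hA).rel n ((cemb (Nat.pair j j) false).1 y) → Zero n := by
    intro n x y h1 h2
    refine (zero_congr h1).2 (zero_of_blk_ne ((ceer hA).rel.trans ((ceer hA).rel.symm h1) h2) ?_)
    simp [cemb, hij]
  have h0 : (ceer hA).rel ((cemb (Nat.pair i j) false).1 0) ((cemb (Nat.pair i j) true).1 0) :=
    rel_of_zero (zero_mem_column _ _) (zero_mem_column _ _)
  have h1 : (ceer hA).rel ((cemb (Nat.pair i j) false).1 1) ((cemb (Nat.pair i j) true).1 1) :=
    (rel_emb_of_ne Bool.false_ne_true).2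
      (Or.inr ⟨by simpa using h, Col.refl _ _, Col.refl _ _⟩)
  constructor
  · intro hle
    obtain ⟨f, g, hff, hfg, -, -, hf, hg⟩ := exists_column_reduction
      (by simpa [kind] using hij) (by simp [kind]) (by simp [kind]) hle
    -- A class common to the edge columns pulls back to a class common to the two diagonal columns,
    -- which is zero. Two distinct common classes would thus come from one.
    have key : ∀ {u v}, (ceer hA).rel ((cemb (Nat.pair i j) false).1 u)
        ((cemb (Nat.pair i j) true).1 v) → ∃ x, Zero ((cemb (Nat.pair i i) false).1 x) ∧
          (ceer hA).rel ((cemb (Nat.pair i j) false).1 u) (f x) := by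
      intro u v huv
      obtain ⟨x, hx⟩ := hf u
      obtain ⟨y, hy⟩ := hg v
      refine ⟨x, hsep ((ceer hA).rel.refl _) ((hfg x y).2 ?_), hx⟩
      exact (ceer hA).rel.trans ((ceer hA).rel.symm hx) ((ceer hA).rel.trans huv hy)
    obtain ⟨x, hx, hxf⟩ := key h0
    obtain ⟨y, hy, hyf⟩ := key h1
    exact not_rel_zero_one (hA := hA) (Nat.pair i j) false ((ceer hA).rel.trans hxf
      ((ceer hA).rel.trans ((hff x y).1 (rel_of_zero hx hy)) ((ceer hA).rel.symm hyf)))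
  · intro hle
    obtain ⟨f, g, hff, hfg, hf, hg, -, -⟩ := exists_column_reduction
      (by simpa [kind] using hij) (by simp [kind]) (by simp [kind]) hle
    -- Conversely, both common classes of the edge block would be sent to the zero class,
    -- identifying `0` with `1`.
    have key : ∀ {u v}, (ceer hA).rel ((cemb (Nat.pair i j) false).1 u)
        ((cemb (Nat.pair i j) true).1 v) → Zero (f u) := by
      intro u v huv
      obtain ⟨x, hx⟩ := hf u
      obtain ⟨y, hy⟩ := hg v
      exact hsep hx ((ceer hA).rel.trans ((hfg u v).1 huv) hy)
    exact not_rel_zero_one (hA := hA) (Nat.pair i j) false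
      ((hff 0 1).2 (rel_of_zero (key h0) (key h1)))

theorem colDeg_le (hA : REPred A) (i : ℕ) : colDeg i ≤ (ceer hA).iDeg := by
  have := sub_cemb hA (Nat.pair i i) false
  rw [show kind (Nat.pair i i) false = i by simp [kind]] at this
  rw [← this]
  exact Ceer.sub_le_iDeg _

/-- A c.e. transversal has at most one zero element; the rest lies in finitely many blocks, so if
infinite it has infinitely many elements in one column. That contradicts goodness: with one element
removed, it would still have to meet the class of this element. -/
theorem isDark (hA : REPred A) : (ceer hA).IsDark := by
  refine ⟨fun hfin => ?_, ?_⟩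
  · exact (good_comap_cemb hA 0 false).1 ((finOver_univ_iff.2 hfin).of_map (cemb 0 false).1
      (fun _ _ => trivial) fun x _ y _ hxy => hxy)
  · rintro ⟨W, hinf, hW, hne⟩
    obtain ⟨n₀, h₀⟩ : ∃ n₀, ∀ n ∈ W, Zero n → n = n₀ := by
      by_cases hz : ∃ n ∈ W, Zero n
      · obtain ⟨n₀, hn₀, hz₀⟩ := hz
        refine ⟨n₀, fun n hn hzn => ?_⟩
        by_contra hnn
        exact hne n hn n₀ hn₀ hnn (rel_of_zero hzn hz₀)
      · exact ⟨0, fun n hn hzn => absurd ⟨n, hn, hzn⟩ hz⟩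
    have hW' : REPred fun n => n ∈ W \ {n₀} :=
      hW.and (REPred.ne Computable.id (Computable.const n₀))
    have hz' : ∀ n ∈ W \ {n₀}, ¬ Zero n := fun n hn hz => hn.2 (h₀ n hn.1 hz)
    obtain ⟨N, hN⟩ := exists_blk_bound hW' hz'
    have hinf' : (W \ {n₀}).Infinite := hinf.sdiff (Set.finite_singleton _)
    have hcol : ∀ k c, {x | (cemb k c).1 x ∈ W \ {n₀}}.Finite := by
      intro k c
      by_contra hi
      obtain ⟨x₀, hx₀⟩ := (show {x | (cemb k c).1 x ∈ W \ {n₀}}.Infinite from hi).nonempty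
      have hi' := Set.Infinite.sdiff hi (Set.finite_singleton x₀)
      have hinj : ∀ x y, (cemb k c).1 x = (cemb k c).1 y → x = y := fun x y hxy => by
        have := congrArg val hxy
        simpa [cemb] using this
      rcases (good_comap_cemb hA k c).2 ({x | (cemb k c).1 x ∈ W \ {n₀}} \ {x₀})
        ((hW'.comp (cemb k c).2).and (REPred.ne Computable.id (Computable.const x₀))) with h | h
      · obtain ⟨x, hx, y, hy, hxy, hr⟩ := h.exists_rel hi'
        exact hne _ hx.1.1 _ hy.1.1 (fun h' => hxy (hinj _ _ h')) hr
      · obtain ⟨x, hx, hr⟩ := h x₀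
        exact hne _ hx₀.1 _ hx.1.1 (fun h' => hx.2 (hinj _ _ h').symm) hr
    refine hinf' (((Set.finite_Iio N).biUnion fun k _ => ((hcol k false).image (cemb k false).1).union
      ((hcol k true).image (cemb k true).1)).subset fun n hn => ?_)
    obtain ⟨x, hx⟩ := exists_emb (hz' n hn)
    refine Set.mem_biUnion (hN n hn) ?_
    cases hs : side n with
    | false =>
      rw [hs] at hx
      exact Or.inl ⟨x, show emb (blk n) false x ∈ W \ {n₀} by rw [← hx]; exact hn, hx.symm⟩
    | true =>
      rw [hs] at hx
      exact Or.inr ⟨x, show emb (blk n) true x ∈ W \ {n₀} by rw [← hx]; exact hn, hx.symm⟩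

end Amalgam

/-! ### The isomorphism of graphs -/

theorem mainTheorem6 (V : Set ℕ) (hV : V.Nonempty) (G : SimpleGraph V)
    (hG : IsComputableGraph G) :
    ∃ c : IDegree, c.IsDark ∧
      ∃ I : Type, Nonempty (c.graph ≃g SimpleGraph.sum G (⊥ : SimpleGraph I)) := by
  have hA : REPred fun p : ℕ × ℕ => ∃ (h₁ : p.1 ∈ V) (h₂ : p.2 ∈ V), G.Adj ⟨p.1, h₁⟩ ⟨p.2, h₂⟩ :=
    hG.2.to_re
  set C := Amalgam.ceer hA with hC
  have hadj : ∀ d e, C.iDeg.graph.Adj d e ↔ ∃ i j : V, d.1 = IDegree.colDeg i ∧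
      e.1 = IDegree.colDeg j ∧ G.Adj i j := by
    intro d e
    constructor
    · rintro ⟨a, b, ha, hb, hab, hade, hbde⟩
      obtain ⟨i, j, hi, hj, h⟩ := Amalgam.exists_adj_of_covers hade hbde ha hb d.2.1 e.2.1 hab.1
      rcases h with ⟨h₁, h₂, h⟩ | ⟨h₁, h₂, h⟩
      · exact ⟨⟨i, h₁⟩, ⟨j, h₂⟩, hi, hj, h⟩
      · exact ⟨⟨i, h₂⟩, ⟨j, h₁⟩, hi, hj, h.symm⟩
    · rintro ⟨i, j, hi, hj, h⟩
      have hij : i.1 ≠ j.1 := fun h' => h.ne (Subtype.ext h')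
      have hinc := Amalgam.incomparable_of_adj (hA := hA) hij ⟨i.2, j.2, h⟩
      -- The two covers are the columns of the blocks `(i, i)` and `(j, j)`, glued only at zero, and
      -- the two columns of the edge block `(i, j)`.
      refine ⟨_, _, Ceer.sub_le_iDeg _, Ceer.sub_le_iDeg _, hinc, ?_, ?_⟩
      · rw [hi, hj]
        simpa [Amalgam.kind] using Amalgam.cover_of_columns (hA := hA) (k := Nat.pair i i)
          (k' := Nat.pair j j) (c := false) (c' := false) (by simpa [Amalgam.kind] using hij)
      · rw [hi, hj]
        simpa [Amalgam.kind] using Amalgam.cover_of_columns (hA := hA) (k := Nat.pair i j)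
          (k' := Nat.pair i j) (c := false) (c' := true) (by simpa [Amalgam.kind] using hij)
  let X := {d : IDegree // IsAtom d ∧ d ≤ C.iDeg}
  -- The isolated vertices: columns with index outside `V`, and any atoms represented by thin sets.
  let I := {d : X // ∀ i : V, d.1 ≠ IDegree.colDeg i}
  let φ : V ⊕ I → X := Sum.elim
    (fun i => ⟨IDegree.colDeg i, IDegree.isAtom_colDeg i, Amalgam.colDeg_le hA i⟩) Subtype.val
  have hφ : Function.Bijective φ := by
    constructor
    · rintro (i | d) (j | e) h
      · exact congrArg Sum.inl (Subtype.ext (IDegree.colDeg_injective (congrArg Subtype.val h)))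
      · exact absurd (congrArg Subtype.val h).symm (e.2 i)
      · exact absurd (congrArg Subtype.val h) (d.2 j)
      · exact congrArg Sum.inr (Subtype.ext h)
    · intro d
      by_cases hd : ∃ i : V, d.1 = IDegree.colDeg i
      · obtain ⟨i, hi⟩ := hd
        exact ⟨Sum.inl i, Subtype.ext hi.symm⟩
      · push Not at hd
        exact ⟨Sum.inr ⟨d, hd⟩, rfl⟩
  refine ⟨C.iDeg, ⟨C, Amalgam.isDark hA, rfl⟩, I, ⟨RelIso.symm ⟨Equiv.ofBijective φ hφ, ?_⟩⟩⟩
  rintro (i | d) (j | e)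
  · rw [hadj]
    constructor
    · rintro ⟨i', j', hi, hj, h⟩
      have hi' : i = i' := Subtype.ext (IDegree.colDeg_injective hi)
      have hj' : j = j' := Subtype.ext (IDegree.colDeg_injective hj)
      subst hi' hj'
      simpa using h
    · intro h
      exact ⟨i, j, rfl, rfl, by simpa using h⟩
  · rw [hadj]
    constructor
    · rintro ⟨i', j', hi, hj, h⟩
      exact absurd hj (e.2 j')
    · intro h
      simp at h
  · rw [hadj]
    constructor
    · rintro ⟨i', j', hi, hj, h⟩
      exact absurd hi (d.2 i')
    · intro h
      simp at h
  · rw [hadj]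
    constructor
    · rintro ⟨i', j', hi, hj, h⟩
      exact absurd hi (d.2 i')
    · intro h
      simp at h
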